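/- Let $C\subset\mathbb R^2$ be an open square, $D$ an open disk with $\overline D\subset C$, and $L>0$. Let $|\cdot|$ denote Lebesgue measure, $\mu_1$ the first eigenvalue of $-\Delta'$ (the Laplacian in the horizontal variables $y\in\mathbb R^2$) in $D$ with homogeneous Dirichlet boundary condition, and $\lambda_0$ the first eigenvalue of $-\frac{d^2}{dx_3^2}$ in $(0,L)$ with homogeneous Dirichlet boundary condition. All functions are real valued, and the equations are understood in the weak sense. Consider the coupled system for $(\lambda,u,v)$ $$ \begin{cases} u\in L^2((0,L);H^1(C)),\quad -\Delta'_y u=\lambda u \ \text{ in } D\times(0,L),\qquad u=v\ \text{ on }\partial D\times(0,L),\\[2pt] v\in H^1_0(0,L),\quad -\dfrac{d^2v}{dx_3^2}=\lambda v+\dfrac{\lambda}{|C\setminus D|}\displaystyle\int_D u(y,\cdot)\,dy\ \text{ in }(0,L), \end{cases}\tag{1} $$ and the system for $(\lambda,u_0,v)$ $$ \begin{cases} u_0\in H^1(C),\quad -\Delta'_y u_0=\lambda u_0+1\ \text{ in } D,\qquad u_0=0\ \text{ on }\partial D,\\[2pt] v\in H^1_0(0,L),\quad -\dfrac{d^2v}{dx_3^2}=\lambda\Bigl(1+\dfrac{|D|}{|C\setminus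 D|}+\dfrac{\lambda}{|C\setminus D|}\displaystyle\int_D u_0\,dy\Bigr)v\ \text{ in }(0,L). \end{cases}\tag{2} $$ Define, for $t\in(0,\mu_1)$, $$\phi(t)=t\left(1+\frac{|D|}{|C\setminus D|}+t\,\frac{|D|}{|C\setminus D|(\mu_1-t)}\right).$$ Then $\phi$ is continuous and strictly increasing on $(0,\mu_1)$, and there is $\mu_0\in(0,\mu_1)$ with $\phi(\mu_0)=\lambda_0$, i.e. $\mu_0=\phi^{-1}(\lambda_0)>0$. Moreover, let $(\lambda,u,v)$ be any solution of (1) with $0<\lambda<\mu_1$ that is nontrivial, i.e. $u$ (on $D\times(0,L)$) and $v$ do not both vanish almost everywhere. Then: 1. $v\neq0$. 2. There is $u_0$, with $u_0=0$ almost everywhere in $C\setminus D$, such that $(\lambda,u_0,v)$ solves (2) and $$u(y,x_3)=(\lambda u_0(y)+1)\,v(x_3)$$ for almost every $(y,x_3)\in D\times(0,L)$. If in addition $u=v$ almost everywhere in $(C\setminus D)\times(0,L)$, then this identity holds almost everywhere in $C\times(0,L)$. 3. For every $u_0$ such that $(\lambda,u_0,v)$ solves (2), $$0<\int_D u_0\,dy\le\frac{|D|}{\mu_1-\lambda}.$$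 4. $\lambda\ge\mu_0$. -/

import Mathlib

open MeasureTheory Set Filter Topology

open scoped ContDiff

section Sobolev

variable {E : Type*} [NormedAddCommGroup E] [InnerProductSpace ℝ E] [FiniteDimensional ℝ E]
  [MeasurableSpace E] [BorelSpace E]

/-- Test functions on `U`: smooth functions with compact support contained in `U`. -/
structure IsTestFunction (U : Set E) (φ : E → ℝ) : Prop where
  smooth : ContDiff ℝ ∞ φ
  compact : HasCompactSupport φ
  support : tsupport φ ⊆ U

/-- `G` is the weak (distributional) gradient of `f` on the open set `U`. -/
def HasWeakGradient (U : Set E) (f : E → ℝ) (G : E → E) : Prop :=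
  ∀ φ : E → ℝ, IsTestFunction U φ → ∀ e : E,
    ∫ x in U, f x * fderiv ℝ φ x e = -∫ x in U, inner ℝ (G x) e * φ x

/-- `f ∈ H¹(U)`, with weak gradient `G`. -/
structure MemH1 (U : Set E) (f : E → ℝ) (G : E → E) : Prop where
  memLp : MemLp f 2 (volume.restrict U)
  memLp_grad : MemLp G 2 (volume.restrict U)
  weakGradient : HasWeakGradient U f G

/-- `f ∈ H¹₀(U)`, with gradient `G`: the pair `(f, G)` is the limit in `L²(U)` of
`(φₙ, ∇φₙ)` for a sequence of test functions `φₙ` on `U`. -/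
structure MemH10 (U : Set E) (f : E → ℝ) (G : E → E) : Prop where
  memLp : MemLp f 2 (volume.restrict U)
  memLp_grad : MemLp G 2 (volume.restrict U)
  approx : ∃ φ : ℕ → E → ℝ, (∀ n, IsTestFunction U (φ n)) ∧
    Tendsto (fun n => eLpNorm (fun x => φ n x - f x) 2 (volume.restrict U)) atTop (𝓝 0) ∧
    Tendsto (fun n => eLpNorm (fun x => gradient (φ n) x - G x) 2 (volume.restrict U))
      atTop (𝓝 0)

/-- `-div G = g` in `U` in the sense of distributions; when `G` is the weak gradient of `f`
on `U` this is the equation `-Δ f = g` in `U`. -/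
def WeakNegDiv (U : Set E) (G : E → E) (g : E → ℝ) : Prop :=
  ∀ φ : E → ℝ, IsTestFunction U φ →
    ∫ x in U, fderiv ℝ φ x (G x) = ∫ x in U, g x * φ x

/-- `μ` is an eigenvalue of `-Δ` in `U` with homogeneous Dirichlet boundary condition. -/
def IsDirichletEigenvalue (U : Set E) (μ : ℝ) : Prop :=
  ∃ (w : E → ℝ) (G : E → E), MemH10 U w G ∧ ¬ (w =ᵐ[volume.restrict U] 0) ∧
    WeakNegDiv U G (fun x => μ * w x)

/-- The first (smallest) eigenvalue of `-Δ` in `U` with homogeneous Dirichlet condition. -/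
noncomputable def firstDirichletEigenvalue (U : Set E) : ℝ :=
  sInf {μ : ℝ | IsDirichletEigenvalue U μ}

end Sobolev

/-- The horizontal plane. -/
abbrev Plane := EuclideanSpace ℝ (Fin 2)

/-- `C` is an open square in the plane (of any position, orientation and side length). -/
def IsOpenSquare (C : Set Plane) : Prop :=
  ∃ (e : Plane ≃ᵢ Plane) (a : ℝ), 0 < a ∧ C = e '' {y : Plane | ∀ i, y i ∈ Ioo 0 a}

/-- `u ∈ L²((0,L); H¹(C))`, with horizontal weak gradient `G`. -/
structure MemL2H1 (C : Set Plane) (L : ℝ) (u : Plane × ℝ → ℝ) (G : Plane × ℝ → Plane) :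
    Prop where
  memLp : MemLp u 2 (volume.restrict (C ×ˢ Ioo 0 L))
  memLp_grad : MemLp G 2 (volume.restrict (C ×ˢ Ioo 0 L))
  memH1 : ∀ᵐ t ∂(volume.restrict (Ioo 0 L)), MemH1 C (fun y => u (y, t)) (fun y => G (y, t))

/-- The coupled system for `(lam, u, v)`:
`u ∈ L²((0,L); H¹(C))`, `-Δ'u = lam u` in `D × (0,L)`, `u = v` on `∂D × (0,L)`,
`v ∈ H¹₀(0,L)`, `-v'' = lam v + (lam / |C \ D|) ∫_D u dy` in `(0,L)`.
The boundary condition says that `u(·,t) - v(t)` belongs to `H¹₀(D)` for a.e. `t`. -/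
def CoupledSystem (C D : Set Plane) (L lam : ℝ) (u : Plane × ℝ → ℝ) (v : ℝ → ℝ) : Prop :=
  ∃ (G : Plane × ℝ → Plane) (V : ℝ → ℝ),
    MemL2H1 C L u G ∧
    (∀ᵐ t ∂(volume.restrict (Ioo 0 L)),
      WeakNegDiv D (fun y => G (y, t)) (fun y => lam * u (y, t))) ∧
    (∀ᵐ t ∂(volume.restrict (Ioo 0 L)),
      MemH10 D (fun y => u (y, t) - v t) (fun y => G (y, t))) ∧
    MemH10 (Ioo 0 L) v V ∧
    WeakNegDiv (Ioo 0 L) V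
      (fun t => lam * v t + lam / volume.real (C \ D) * ∫ y in D, u (y, t))

/-- The reduced system for `(lam, u₀, v)`:
`u₀ ∈ H¹(C)`, `-Δ'u₀ = lam u₀ + 1` in `D`, `u₀ = 0` on `∂D`, `v ∈ H¹₀(0,L)`,
`-v'' = lam (1 + |D| / |C \ D| + (lam / |C \ D|) ∫_D u₀ dy) v` in `(0,L)`. -/
def ReducedSystem (C D : Set Plane) (L lam : ℝ) (u₀ : Plane → ℝ) (v : ℝ → ℝ) : Prop :=
  ∃ (G : Plane → Plane) (V : ℝ → ℝ),
    MemH1 C u₀ G ∧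
    WeakNegDiv D G (fun y => lam * u₀ y + 1) ∧
    MemH10 D u₀ G ∧
    MemH10 (Ioo 0 L) v V ∧
    WeakNegDiv (Ioo 0 L) V
      (fun t => lam * (1 + volume.real D / volume.real (C \ D)
        + lam / volume.real (C \ D) * ∫ y in D, u₀ y) * v t)

/-- `phi t = t (1 + |D| / |C \ D| + t |D| / (|C \ D| (μ₁ - t)))`, where `μ₁` is the first
Dirichlet eigenvalue of `-Δ'` in `D`. -/
noncomputable def phi (C D : Set Plane) (t : ℝ) : ℝ :=
  t * (1 + volume.real D / volume.real (C \ D)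
    + t * (volume.real D / (volume.real (C \ D) * (firstDirichletEigenvalue D - t))))

/-! For almost every height `t`, the slice `u(·,t) - v(t)` lies in `H¹₀(D)` and `-Δ'` of it equals
`lam * u(·,t)`. At a height with `v(t) ≠ 0`, dividing by `lam * v(t)` gives a solution `u₀` of
`-Δ'u₀ = lam u₀ + 1`. Since `lam < μ₁`, the Dirichlet problem has at most one solution, so every
slice is `(lam u₀ + 1) v(s)`. Integrating over `D` decouples the equation for `v`; its coefficient
is then a Dirichlet eigenvalue of `(0,L)`, hence at least `λ₀`. Testing the `u₀` equation with `u₀`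
and using the Poincaré and Cauchy–Schwarz inequalities gives `0 < ∫ u₀ ≤ |D| / (μ₁ - lam)`. The
coefficient is therefore at most `phi lam`, so `phi μ₀ = λ₀ ≤ phi lam`, and monotonicity of `phi`
gives `μ₀ ≤ lam`.

The analytic core is `firstDirichletEigenvalue_spec`: the infimum of the eigenvalues is positive,
attained, and the optimal Poincaré constant. It minimises the Rayleigh quotient on `H¹₀`;
compactness comes from an Ehrling inequality, itself a consequence of the translation estimate
`integral_sq_sub_translate_le`. -/

lemma eq_zero_of_forall_quadratic_nonneg {b q : ℝ} (hq : 0 ≤ q)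
    (h : ∀ t : ℝ, 0 ≤ 2 * t * b + t ^ 2 * q) : b = 0 := by
  -- The vertex of the parabola is `-b / q`; the shift by 1 also covers `q = 0` and still gives a
  -- negative value unless `b = 0`.
  have h1 := h (-b / (q + 1))
  have hq1 : 0 < q + 1 := by linarith
  have h2 : 2 * (-b / (q + 1)) * b + (-b / (q + 1)) ^ 2 * q
      = -(b ^ 2 * (q + 2)) / (q + 1) ^ 2 := by
    field_simp; ring
  rw [h2, neg_div, Left.nonneg_neg_iff] at h1
  have h3 : b ^ 2 * (q + 2) ≤ 0 := by
    by_contra hc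
    push Not at hc
    have : 0 < b ^ 2 * (q + 2) / (q + 1) ^ 2 := by positivity
    linarith
  have h4 : b ^ 2 ≤ 0 := by nlinarith [sq_nonneg b]
  exact pow_eq_zero_iff (two_ne_zero) |>.1 (le_antisymm h4 (sq_nonneg b))

/-! ### Minimising an abstract Rayleigh quotient -/

section Rayleigh

variable {X Y : Type*} [NormedAddCommGroup X] [InnerProductSpace ℝ X] [NormedAddCommGroup Y]

/-- An Ehrling-type inequality: the first component of a pair in `H` is controlled by an
arbitrarily small multiple of the second one, up to finitely many linear functionals. -/
def EhrlingInequality (H : Set (X × Y)) : Prop :=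
  ∀ η : ℝ, 0 < η → ∃ (s : Finset X) (K : ℝ), ∀ p ∈ H,
    ‖p.1‖ ^ 2 ≤ η * ‖p.2‖ ^ 2 + K * ∑ e ∈ s, (inner ℝ e p.1) ^ 2

lemma exists_tendsto_ultrafilter_of_bounded {ι : Type*} (U : Ultrafilter ι) (f : ι → ℝ) (M : ℝ)
    (h : ∀ i, |f i| ≤ M) : ∃ a, Tendsto f U (𝓝 a) := by
  have hK : IsCompact (Icc (-M) M) := isCompact_Icc
  obtain ⟨a, -, ha⟩ := hK.ultrafilter_le_nhds (U.map f)
    (by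
      rw [le_principal_iff, Ultrafilter.mem_coe, Ultrafilter.mem_map]
      exact Filter.univ_mem' fun i => abs_le.1 (h i))
  exact ⟨a, ha⟩

variable [InnerProductSpace ℝ Y]

/-- A bounded family in `H` is Cauchy in `X` along any ultrafilter. -/
lemma EhrlingInequality.tendsto_dist {H : Submodule ℝ (X × Y)}
    (h : EhrlingInequality (H : Set (X × Y))) {ι : Type*} (U : Ultrafilter ι)
    (p : ι → X × Y) (hp : ∀ i, p i ∈ H) (M N : ℝ) (hM : ∀ i, ‖(p i).2‖ ≤ M)
    (hN : ∀ i, ‖(p i).1‖ ≤ N) :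
    Tendsto (fun q : ι × ι => dist (p q.1).1 (p q.2).1) ((U : Filter ι) ×ˢ (U : Filter ι))
      (𝓝 0) := by
  rw [Metric.tendsto_nhds]
  intro ε hε
  have hM0 : 0 ≤ M := by
    obtain ⟨i⟩ := U.neBot.nonempty
    exact (norm_nonneg _).trans (hM i)
  -- Differences of second components have squared norm at most `4 * M ^ 2`, so their contribution
  -- stays below `ε ^ 2 / 2`; the `+ 1` covers `M = 0`.
  set η : ℝ := ε ^ 2 / (2 * (4 * M ^ 2 + 1)) with hη
  obtain ⟨s, K, hs⟩ := h η (by positivity)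
  have hlim : Tendsto (fun q : ι × ι =>
      K * ∑ e ∈ s, (inner ℝ e (p q.1).1 - inner ℝ e (p q.2).1 : ℝ) ^ 2)
      ((U : Filter ι) ×ˢ (U : Filter ι)) (𝓝 (K * ∑ e ∈ s, (0 : ℝ) ^ 2)) := by
    refine Tendsto.const_mul K (tendsto_finsetSum s fun e _ => Tendsto.pow ?_ 2)
    -- Along an ultrafilter every bounded functional converges, so no diagonal extraction of
    -- subsequences is needed.
    obtain ⟨a, ha⟩ := exists_tendsto_ultrafilter_of_bounded U
      (fun i => (inner ℝ e (p i).1 : ℝ)) (‖e‖ * N)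
      (fun i => (abs_real_inner_le_norm _ _).trans
        (mul_le_mul_of_nonneg_left (hN i) (norm_nonneg _)))
    simpa using (ha.comp tendsto_fst).sub (ha.comp tendsto_snd)
  simp only [ne_eq, OfNat.ofNat_ne_zero, not_false_eq_true, zero_pow, Finset.sum_const_zero,
    mul_zero] at hlim
  filter_upwards [hlim.eventually (gt_mem_nhds (show (0 : ℝ) < ε ^ 2 / 2 by positivity))]
    with q hq
  have h1 := hs (p q.1 - p q.2) (H.sub_mem (hp _) (hp _))
  simp only [Prod.fst_sub, Prod.snd_sub, inner_sub_right] at h1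
  have h2 : ‖(p q.1).2 - (p q.2).2‖ ≤ 2 * M := by
    refine (norm_sub_le _ _).trans ?_
    linarith [hM q.1, hM q.2]
  have h3 : ‖(p q.1).2 - (p q.2).2‖ ^ 2 ≤ 4 * M ^ 2 := by
    nlinarith [norm_nonneg ((p q.1).2 - (p q.2).2)]
  have h4 : η * ‖(p q.1).2 - (p q.2).2‖ ^ 2 ≤ ε ^ 2 / 2 := by
    calc η * ‖(p q.1).2 - (p q.2).2‖ ^ 2 ≤ η * (4 * M ^ 2 + 1) := by
          gcongr; linarith
      _ = ε ^ 2 / 2 := by rw [hη]; field_simp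
  rw [Real.dist_eq, sub_zero, abs_of_nonneg dist_nonneg, dist_eq_norm]
  exact lt_of_pow_lt_pow_left₀ 2 hε.le (by linarith)

/-- The Rayleigh quotient `‖p.2‖² / ‖p.1‖²` attains its minimum on a closed subspace satisfying
an Ehrling-type inequality, and minimisers satisfy the Euler–Lagrange equation. -/
theorem EhrlingInequality.exists_minimizer [CompleteSpace X] [CompleteSpace Y] {H : Submodule ℝ (X × Y)}
    (h : EhrlingInequality (H : Set (X × Y))) (hH : IsClosed (H : Set (X × Y)))
    (hne : ∃ p ∈ H, p.1 ≠ 0) :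
    ∃ (m : ℝ), ∃ w ∈ H, w.1 ≠ 0 ∧ (∀ p ∈ H, inner ℝ p.2 w.2 = m * inner ℝ w.1 p.1) ∧
      ∀ p ∈ H, m * ‖p.1‖ ^ 2 ≤ ‖p.2‖ ^ 2 := by
  set S : Set ℝ := {a | ∃ p ∈ H, ‖p.1‖ = 1 ∧ ‖p.2‖ ^ 2 = a} with hS
  have hbdd : BddBelow S := ⟨0, by rintro a ⟨p, -, -, rfl⟩; positivity⟩
  have hnorm : ∀ p ∈ H, p.1 ≠ 0 → ‖p.2‖ ^ 2 / ‖p.1‖ ^ 2 ∈ S := by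
    intro p hp hp0
    refine ⟨‖p.1‖⁻¹ • p, H.smul_mem _ hp, ?_, ?_⟩
    · rw [Prod.smul_fst, norm_smul, norm_inv, norm_norm,
        inv_mul_cancel₀ (norm_ne_zero_iff.2 hp0)]
    · rw [Prod.smul_snd, norm_smul, norm_inv, norm_norm, mul_pow, inv_pow, div_eq_inv_mul]
  have hSne : S.Nonempty := by
    obtain ⟨p, hp, hp0⟩ := hne
    exact ⟨_, hnorm p hp hp0⟩
  set m : ℝ := sInf S with hm
  have hray : ∀ p ∈ H, m * ‖p.1‖ ^ 2 ≤ ‖p.2‖ ^ 2 := by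
    intro p hp
    by_cases hp0 : p.1 = 0
    · simp [hp0]
    · have h1 := csInf_le hbdd (hnorm p hp hp0)
      rwa [le_div_iff₀ (by positivity)] at h1
  obtain ⟨a, -, ha, haS⟩ := exists_seq_tendsto_sInf hSne hbdd
  choose p hp hp1 hpa using haS
  obtain ⟨B, hB⟩ := ha.bddAbove_range
  have hM : ∀ n, ‖(p n).2‖ ≤ B + 1 := by
    intro n
    have h1 : ‖(p n).2‖ ^ 2 ≤ B := by rw [hpa]; exact hB ⟨n, rfl⟩
    nlinarith [sq_nonneg (‖(p n).2‖ - 1 / 2), norm_nonneg (p n).2]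
  set U : Ultrafilter ℕ := hyperfilter ℕ
  have hU : (U : Filter ℕ) ≤ atTop := by
    rw [← Nat.cofinite_eq_atTop]; exact hyperfilter_le_cofinite
  have haU : Tendsto a U (𝓝 m) := ha.mono_left hU
  have hc1 : Cauchy (map (fun n => (p n).1) (U : Filter ℕ)) := by
    rw [cauchy_map_iff]
    exact ⟨U.neBot, tendsto_uniformity_iff_dist_tendsto_zero.2
      (h.tendsto_dist U p hp (B + 1) 1 hM fun n => (hp1 n).le)⟩
  obtain ⟨w, hw⟩ := CompleteSpace.complete hc1
  replace hw : Tendsto (fun n => (p n).1) U (𝓝 w) := hw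
  have hw1 : ‖w‖ = 1 :=
    tendsto_nhds_unique hw.norm (by simp [hp1])
  have hc2 : Cauchy (map (fun n => (p n).2) (U : Filter ℕ)) := by
    rw [cauchy_map_iff]
    refine ⟨U.neBot, tendsto_uniformity_iff_dist_tendsto_zero.2 ?_⟩
    -- The parallelogram law, with the Rayleigh bound applied to the sum of two members, bounds the
    -- squared distance by a quantity tending to `4m - 4m = 0`. This upgrades boundedness of the
    -- second components to strong convergence.
    have hsq : Tendsto (fun q : ℕ × ℕ => dist (p q.1).2 (p q.2).2 ^ 2)
        ((U : Filter ℕ) ×ˢ (U : Filter ℕ)) (𝓝 0) := by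
      have hlim : Tendsto (fun q : ℕ × ℕ => 2 * a q.1 + 2 * a q.2
          - m * ‖(p q.1).1 + (p q.2).1‖ ^ 2) ((U : Filter ℕ) ×ˢ (U : Filter ℕ))
          (𝓝 (2 * m + 2 * m - m * ‖w + w‖ ^ 2)) := by
        refine ((haU.comp tendsto_fst).const_mul 2).add ((haU.comp tendsto_snd).const_mul 2)
          |>.sub (Tendsto.const_mul m (Tendsto.pow (Tendsto.norm ?_) 2))
        exact (hw.comp tendsto_fst).add (hw.comp tendsto_snd)
      have h0 : 2 * m + 2 * m - m * ‖w + w‖ ^ 2 = 0 := by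
        rw [← two_smul ℝ w, norm_smul, hw1]; norm_num; ring
      rw [h0] at hlim
      refine squeeze_zero (fun q => by positivity) (fun q => ?_) hlim
      have h1 := hray _ (H.add_mem (hp q.1) (hp q.2))
      have h2 := parallelogram_law_with_norm ℝ (p q.1).2 (p q.2).2
      simp only [Prod.fst_add, Prod.snd_add] at h1
      rw [dist_eq_norm, ← hpa, ← hpa]
      nlinarith
    have := hsq.sqrt
    simpa [Real.sqrt_sq dist_nonneg] using this
  obtain ⟨z, hz⟩ := CompleteSpace.complete hc2
  replace hz : Tendsto (fun n => (p n).2) U (𝓝 z) := hz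
  have hwz : (w, z) ∈ H :=
    hH.mem_of_tendsto (b := (U : Filter ℕ)) (hw.prodMk_nhds hz) (Eventually.of_forall hp)
  have hzm : ‖z‖ ^ 2 = m :=
    tendsto_nhds_unique (hz.norm.pow 2) (by simpa only [hpa] using haU)
  refine ⟨m, (w, z), hwz, ?_, fun q hq => ?_, hray⟩
  · rw [← norm_ne_zero_iff]; simp [hw1]
  · have hq0 : 0 ≤ ‖q.2‖ ^ 2 - m * ‖q.1‖ ^ 2 := sub_nonneg.2 (hray q hq)
    -- First variation: along `w + t q` the Rayleigh defect is a nonnegative quadratic in `t`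
    -- without constant term, so its linear coefficient vanishes.
    have := eq_zero_of_forall_quadratic_nonneg
      (b := inner ℝ z q.2 - m * inner ℝ w q.1) hq0 (fun t => by
        have h1 := hray _ (H.add_mem hwz (H.smul_mem t hq))
        simp only [Prod.fst_add, Prod.snd_add, Prod.smul_fst, Prod.smul_snd] at h1
        rw [norm_add_sq_real, norm_add_sq_real, hw1, hzm, norm_smul, norm_smul,
          inner_smul_right, inner_smul_right, mul_pow, mul_pow, Real.norm_eq_abs, sq_abs] at h1
        linarith)
    rw [real_inner_comm]
    exact sub_eq_zero.1 this

end Rayleigh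

/-- Cauchy–Schwarz against the constant 1, obtained by integrating `(V * f - I) ^ 2 ≥ 0`. -/
lemma sq_integral_le_measureReal_mul {α : Type*} [MeasurableSpace α] {μ : Measure α}
    [IsFiniteMeasure μ] {f : α → ℝ} (hf : MemLp f 2 μ) :
    (∫ x, f x ∂μ) ^ 2 ≤ μ.real univ * ∫ x, f x ^ 2 ∂μ := by
  have hf1 : Integrable f μ := hf.integrable (by norm_num)
  have hf2 : Integrable (fun x => f x ^ 2) μ := hf.integrable_sq
  rcases eq_zero_or_neZero μ with h0 | h0
  · simp [h0]
  have hV : 0 < μ.real univ := measureReal_univ_pos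
  set V := μ.real univ
  set I := ∫ x, f x ∂μ
  have h1 : 0 ≤ ∫ x, (V ^ 2 * f x ^ 2 - 2 * V * I * f x + I ^ 2) ∂μ :=
    integral_nonneg fun x => by
      have : V ^ 2 * f x ^ 2 - 2 * V * I * f x + I ^ 2 = (V * f x - I) ^ 2 := by ring
      rw [this]; positivity
  have hi1 := hf2.const_mul (V ^ 2)
  have hi2 := hf1.const_mul (2 * V * I)
  have hi3 : Integrable (fun x => V ^ 2 * f x ^ 2 - 2 * V * I * f x) μ := hi1.sub hi2
  rw [integral_add hi3 (integrable_const _), integral_sub hi1 hi2, integral_const_mul, integral_const_mul,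
    integral_const, smul_eq_mul] at h1
  have h2 : 0 ≤ V * (V * ∫ x, f x ^ 2 ∂μ - I ^ 2) := by
    convert h1 using 1
    change _ = V ^ 2 * ∫ x, f x ^ 2 ∂μ - 2 * V * I * I + V * I ^ 2
    ring
  have h3 := nonneg_of_mul_nonneg_right h2 hV
  linarith

lemma HasCompactSupport.fun_sq {α : Type*} [TopologicalSpace α] {f : α → ℝ}
    (hf : HasCompactSupport f) : HasCompactSupport fun x => f x ^ 2 :=
  hf.mono fun x hx h => hx (by simp [h])

/-! ### Translation estimates, Poincaré and Ehrling inequalities -/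

section Translation

variable {E : Type*} [NormedAddCommGroup E] [InnerProductSpace ℝ E] [FiniteDimensional ℝ E]

lemma ContDiff.continuous_gradient_of_one_le {φ : E → ℝ} (hφ : ContDiff ℝ 1 φ) :
    Continuous (gradient φ) :=
  (InnerProductSpace.toDual ℝ E).symm.continuous.comp (hφ.continuous_fderiv one_ne_zero)

lemma HasCompactSupport.gradient {φ : E → ℝ} (hφ : HasCompactSupport φ) :
    HasCompactSupport (gradient φ) :=
  (hφ.fderiv ℝ).comp_left (g := (InnerProductSpace.toDual ℝ E).symm) (map_zero _)

lemma inner_gradient_eq_fderiv (φ : E → ℝ) (x e : E) :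
    inner ℝ (gradient φ x) e = fderiv ℝ φ x e := by
  simp [gradient]

/-- The fundamental theorem of calculus along the segment from `x` to `x + z`, then Cauchy–Schwarz
on the unit interval. -/
lemma sub_translate_sq_le {φ : E → ℝ} (hφ : ContDiff ℝ 1 φ) (x z : E) :
    (φ (x + z) - φ x) ^ 2 ≤ ∫ t in Ioc (0 : ℝ) 1, ‖z‖ ^ 2 * ‖gradient φ (x + t • z)‖ ^ 2 := by
  have hg : Continuous (fun t : ℝ => fderiv ℝ φ (x + t • z) z) := by
    have := hφ.continuous_fderiv one_ne_zero
    fun_prop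
  have hg2 := hφ.continuous_gradient_of_one_le
  have h1 : ∫ t in (0 : ℝ)..1, fderiv ℝ φ (x + t • z) z = φ (x + z) - φ x := by
    have hd : ∀ t ∈ uIcc (0 : ℝ) 1, HasDerivAt (fun t : ℝ => φ (x + t • z))
        (fderiv ℝ φ (x + t • z) z) t := by
      intro t _
      have hl : HasDerivAt (fun t : ℝ => x + t • z) z t := by
        simpa using ((hasDerivAt_id t).smul_const z).const_add x
      exact ((hφ.differentiable (by norm_num)) _).hasFDerivAt.comp_hasDerivAt t hl
    have := intervalIntegral.integral_eq_sub_of_hasDerivAt hd (hg.intervalIntegrable _ _)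
    simpa using this
  rw [← h1, intervalIntegral.integral_of_le zero_le_one]
  have hmem : MemLp (fun t : ℝ => fderiv ℝ φ (x + t • z) z) 2 (volume.restrict (Ioc (0 : ℝ) 1)) :=
    (memLp_two_iff_integrable_sq hg.aestronglyMeasurable).2
      ((hg.pow 2).integrableOn_Icc.mono_set Ioc_subset_Icc_self)
  refine (sq_integral_le_measureReal_mul hmem).trans ?_
  have hV : (volume.restrict (Ioc (0 : ℝ) 1)).real univ = 1 := by simp
  rw [hV, one_mul]
  refine integral_mono_ae hmem.integrable_sq ?_ (Eventually.of_forall fun t => ?_)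
  · exact ((show Continuous fun t : ℝ => ‖z‖ ^ 2 * ‖gradient φ (x + t • z)‖ ^ 2 by
      fun_prop).integrableOn_Icc).mono_set Ioc_subset_Icc_self
  · change (fderiv ℝ φ (x + t • z) z) ^ 2 ≤ _
    change _ ≤ ‖z‖ ^ 2 * ‖gradient φ (x + t • z)‖ ^ 2
    rw [← inner_gradient_eq_fderiv, ← mul_pow, ← sq_abs, mul_comm ‖z‖]
    exact pow_le_pow_left₀ (abs_nonneg _) (abs_real_inner_le_norm _ _) 2

variable [MeasurableSpace E] [BorelSpace E]

lemma integrable_norm_sq_gradient {φ : E → ℝ} (hφ : ContDiff ℝ 1 φ) (hc : HasCompactSupport φ) :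
    Integrable (fun x => ‖gradient φ x‖ ^ 2) :=
  (hφ.continuous_gradient_of_one_le.norm.pow 2).integrable_of_hasCompactSupport
    hc.gradient.norm.fun_sq

/-- The `L²` modulus of continuity of a compactly supported `C¹` function is controlled by its
Dirichlet energy. -/
lemma integral_sq_sub_translate_le {φ : E → ℝ} (hφ : ContDiff ℝ 1 φ) (hc : HasCompactSupport φ)
    (z : E) :
    ∫ x, (φ (x + z) - φ x) ^ 2 ≤ ‖z‖ ^ 2 * ∫ x, ‖gradient φ x‖ ^ 2 := by
  have hcont := hφ.continuous
  have hg := hφ.continuous_gradient_of_one_le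
  have hJ := integrable_norm_sq_gradient hφ hc
  rw [integral_eq_lintegral_of_nonneg_ae (Eventually.of_forall fun x => sq_nonneg _)
    (by fun_prop)]
  refine ENNReal.toReal_le_of_le_ofReal (by positivity) ?_
  have hF : Continuous fun q : E × ℝ => ‖z‖ ^ 2 * ‖gradient φ (q.1 + q.2 • z)‖ ^ 2 := by
    fun_prop
  -- After exchanging the integrals, translation invariance makes the inner one independent of `t`.
  calc ∫⁻ x, ENNReal.ofReal ((φ (x + z) - φ x) ^ 2)
      ≤ ∫⁻ x : E, ∫⁻ t in Ioc (0 : ℝ) 1,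
          ENNReal.ofReal (‖z‖ ^ 2 * ‖gradient φ (x + t • z)‖ ^ 2) := by
        refine lintegral_mono fun x => ?_
        refine (ENNReal.ofReal_le_ofReal (sub_translate_sq_le hφ x z)).trans ?_
        rw [ofReal_integral_eq_lintegral_ofReal]
        · exact ((show Continuous fun t : ℝ => ‖z‖ ^ 2 * ‖gradient φ (x + t • z)‖ ^ 2 by
            fun_prop).integrableOn_Icc).mono_set Ioc_subset_Icc_self
        · exact Eventually.of_forall fun t => by positivity
    _ = ∫⁻ t in Ioc (0 : ℝ) 1, ∫⁻ x : E,
          ENNReal.ofReal (‖z‖ ^ 2 * ‖gradient φ (x + t • z)‖ ^ 2) := by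
        refine lintegral_lintegral_swap ?_
        exact (ENNReal.continuous_ofReal.comp hF).measurable.aemeasurable
    _ = ∫⁻ t in Ioc (0 : ℝ) 1, ENNReal.ofReal (‖z‖ ^ 2 * ∫ x, ‖gradient φ x‖ ^ 2) := by
        refine lintegral_congr fun t => ?_
        rw [lintegral_add_right_eq_self
          (fun x => ENNReal.ofReal (‖z‖ ^ 2 * ‖gradient φ x‖ ^ 2)) (t • z),
          ← integral_const_mul, ofReal_integral_eq_lintegral_ofReal (hJ.const_mul _)
            (Eventually.of_forall fun x => by positivity)]
    _ = ENNReal.ofReal (‖z‖ ^ 2 * ∫ x, ‖gradient φ x‖ ^ 2) := by simp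

lemma integrable_sq_of_continuous {φ : E → ℝ} (hφ : Continuous φ) (hc : HasCompactSupport φ) :
    Integrable (fun x => φ x ^ 2) :=
  (hφ.pow 2).integrable_of_hasCompactSupport hc.fun_sq

/-- Poincaré's inequality on bounded sets. -/
lemma exists_poincare [Nontrivial E] {U : Set E} (hU : Bornology.IsBounded U) :
    ∃ P : ℝ, ∀ φ : E → ℝ, ContDiff ℝ 1 φ → HasCompactSupport φ → tsupport φ ⊆ U →
      ∫ x, φ x ^ 2 ≤ P * ∫ x, ‖gradient φ x‖ ^ 2 := by
  obtain ⟨R, hR⟩ := hU.subset_closedBall 0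
  -- A shift longer than the diameter of the ball makes `φ` and its translate have disjoint
  -- supports, so their squared difference integrates to at least `∫ φ ^ 2`.
  obtain ⟨z, hz⟩ := exists_norm_eq E (show 0 ≤ 2 * |R| + 1 by positivity)
  refine ⟨‖z‖ ^ 2, fun φ hφ hc hs => ?_⟩
  refine le_trans ?_ (integral_sq_sub_translate_le hφ hc z)
  have hcont := hφ.continuous
  have hpt : ∀ x, φ (x + z) * φ x = 0 := by
    intro x
    by_contra hne
    have h1 := hR (hs (subset_tsupport φ (Function.mem_support.2 (right_ne_zero_of_mul hne))))
    have h2 := hR (hs (subset_tsupport φ (Function.mem_support.2 (left_ne_zero_of_mul hne))))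
    rw [mem_closedBall_zero_iff] at h1 h2
    have h3 : ‖z‖ ≤ ‖x + z‖ + ‖x‖ := by simpa using norm_sub_le (x + z) x
    linarith [le_abs_self R]
  have hi1 := integrable_sq_of_continuous hcont hc
  have hi2 : Integrable (fun x => φ (x + z) ^ 2) := hi1.comp_add_right z
  have : ∀ x, (φ (x + z) - φ x) ^ 2 = φ (x + z) ^ 2 + φ x ^ 2 := fun x => by
    linear_combination (-2) * hpt x
  simp_rw [this]
  rw [integral_add hi2 hi1]
  have : 0 ≤ ∫ x, φ (x + z) ^ 2 := integral_nonneg fun x => by positivity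
  linarith

/-- Ehrling's inequality for ball averages: on a bounded set, the `L²` norm is controlled by a
small multiple of the Dirichlet energy and finitely many integrals over balls. -/
lemma exists_integral_sq_le_ball_averages {U : Set E} (hU : Bornology.IsBounded U) {η : ℝ}
    (hη : 0 < η) : ∃ (s : Finset E) (ε K : ℝ), 0 ≤ K ∧
      ∀ φ : E → ℝ, ContDiff ℝ 1 φ → HasCompactSupport φ → tsupport φ ⊆ U →
        ∫ x, φ x ^ 2 ≤ η * (∫ x, ‖gradient φ x‖ ^ 2) +
          K * ∑ e ∈ s, (∫ x in Metric.ball e ε, φ x) ^ 2 := by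
  obtain ⟨R, hR⟩ := hU.subset_closedBall 0
  -- `ε` is the averaging radius and `δ` below the mesh of the net of centres. They are tuned so
  -- that replacing `φ` by its averages, and then moving to a nearby centre, each costs at most `η /
  -- 2` times the energy.
  set ε : ℝ := √(η / 4) with hε
  have hε0 : 0 < ε := by positivity
  have hε2 : ε ^ 2 = η / 4 := Real.sq_sqrt (by positivity)
  set B : Set E := Metric.ball 0 ε with hB
  set b : ℝ := volume.real B with hb
  have hb0 : 0 < b := ENNReal.toReal_pos (Metric.measure_ball_pos _ _ hε0).ne'
    measure_ball_lt_top.ne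
  have : IsFiniteMeasure (volume.restrict B) := ⟨by simpa using measure_ball_lt_top⟩
  set V : ℝ := volume.real (Metric.closedBall (0 : E) R) with hV
  have hV0 : 0 ≤ V := measureReal_nonneg
  have : IsFiniteMeasure (volume.restrict (Metric.closedBall (0 : E) R)) :=
    ⟨by simpa using measure_closedBall_lt_top⟩
  set δ : ℝ := √(b * η / (8 * (V + 1))) with hδ
  have hδ0 : 0 < δ := by positivity
  have hδ2 : δ ^ 2 = b * η / (8 * (V + 1)) := Real.sq_sqrt (by positivity)
  obtain ⟨s, hs⟩ : ∃ s : Finset E, ∀ x ∈ Metric.closedBall (0 : E) R, ∃ e ∈ s, ‖x - e‖ < δ := by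
    obtain ⟨t, -, htf, ht⟩ := finite_cover_balls_of_compact
      (isCompact_closedBall (0 : E) R) hδ0
    refine ⟨htf.toFinset, fun x hx => ?_⟩
    obtain ⟨e, he, hxe⟩ := mem_iUnion₂.1 (ht hx)
    exact ⟨e, htf.mem_toFinset.2 he, by simpa [dist_eq_norm] using hxe⟩
  refine ⟨s, ε, V * (4 / b ^ 2), by positivity, fun φ hφ hc hsupp => ?_⟩
  have hcont := hφ.continuous
  set J : ℝ := ∫ x, ‖gradient φ x‖ ^ 2 with hJ
  have hJ0 : 0 ≤ J := integral_nonneg fun x => by positivity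
  set A : E → ℝ := fun x => ∫ z in B, φ (x + z) with hA
  set Q : ℝ := ∑ e ∈ s, (∫ x in Metric.ball e ε, φ x) ^ 2 with hQ
  have hAe : ∀ e, A e = ∫ x in Metric.ball e ε, φ x := by
    intro e
    have h := (measurePreserving_add_left (volume : Measure E) e).setIntegral_preimage_emb
      (MeasurableEquiv.addLeft e).measurableEmbedding φ (Metric.ball e ε)
    rw [← h]
    have hpre : MeasurableEquiv.addLeft e ⁻¹' Metric.ball e ε = B := by
      ext x; simp [hB]
    change ∫ z in B, φ (e + z) = ∫ z in MeasurableEquiv.addLeft e ⁻¹' Metric.ball e ε, φ (e + z)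
    rw [hpre]
  obtain ⟨Cφ, hCφ⟩ := hc.exists_bound_of_continuous hcont
  have hmem : ∀ f : E → ℝ, Continuous f → (∀ x, ‖f x‖ ≤ 2 * Cφ) →
      MemLp f 2 (volume.restrict B) := fun f hf hfb =>
    MemLp.of_bound hf.aestronglyMeasurable (2 * Cφ) (Eventually.of_forall hfb)
  have hbd : ∀ x y, ‖φ x - φ y‖ ≤ 2 * Cφ := fun x y =>
    (norm_sub_le _ _).trans (by linarith [hCφ x, hCφ y])
  have hC0 : 0 ≤ Cφ := (norm_nonneg _).trans (hCφ 0)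
  have hint : ∀ x, Integrable (fun z => φ (x + z)) (volume.restrict B) := fun x =>
    (hmem _ (by fun_prop) fun z => (hCφ _).trans (by linarith)).integrable (by norm_num)
  -- oscillation of the averages
  have hosc : ∀ x e : E, (A x - A e) ^ 2 ≤ b * (‖x - e‖ ^ 2 * J) := by
    intro x e
    have h1 : A x - A e = ∫ z in B, (φ (x + z) - φ (e + z)) :=
      (integral_sub (hint x) (hint e)).symm
    have hm := hmem (fun z => φ (x + z) - φ (e + z)) (by fun_prop) fun z => hbd _ _
    rw [h1]
    refine (sq_integral_le_measureReal_mul hm).trans ?_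
    rw [measureReal_restrict_apply_univ]
    refine mul_le_mul_of_nonneg_left ?_ hb0.le
    have hi : Integrable (fun z => (φ (x + z) - φ (e + z)) ^ 2) := by
      refine Continuous.integrable_of_hasCompactSupport (by fun_prop) ?_
      have h1 : HasCompactSupport fun z => φ (x + z) :=
        hc.comp_homeomorph (Homeomorph.addLeft x)
      have h2 : HasCompactSupport fun z => φ (e + z) :=
        hc.comp_homeomorph (Homeomorph.addLeft e)
      exact (h1.sub h2).fun_sq
    refine (setIntegral_le_integral hi (Eventually.of_forall fun z => sq_nonneg _)).trans ?_
    have h2 := integral_add_right_eq_self (μ := (volume : Measure E))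
      (fun z => (φ (z + (x - e)) - φ z) ^ 2) e
    have h3 : ∀ z, (φ (z + e + (x - e)) - φ (z + e)) ^ 2 = (φ (x + z) - φ (e + z)) ^ 2 := by
      intro z
      rw [show z + e + (x - e) = x + z by abel, add_comm z e]
    simp_rw [h3] at h2
    rw [h2]
    exact integral_sq_sub_translate_le hφ hc _
  have hpt : ∀ x ∈ Metric.closedBall (0 : E) R, φ x ^ 2 ≤
      (2 / b) * (∫ z in B, (φ (x + z) - φ x) ^ 2) + (4 / b ^ 2 * Q + 4 / b * (δ ^ 2 * J)) := by
    intro x hx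
    have h1 : A x - b * φ x = ∫ z in B, (φ (x + z) - φ x) := by
      rw [integral_sub (hint x) (integrable_const _)]; simp [hA, hb, Measure.real]
    have h2 : (A x - b * φ x) ^ 2 ≤ b * ∫ z in B, (φ (x + z) - φ x) ^ 2 := by
      rw [h1]
      have := sq_integral_le_measureReal_mul
        (hmem (fun z => φ (x + z) - φ x) (by fun_prop) fun z => hbd _ _)
      rwa [measureReal_restrict_apply_univ] at this
    obtain ⟨e, he, hxe⟩ := hs x hx
    have h3 : A e ^ 2 ≤ Q := by
      rw [hAe]
      exact Finset.single_le_sum (f := fun e => (∫ x in Metric.ball e ε, φ x) ^ 2)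
        (fun i _ => sq_nonneg _) he
    have h4 : (A x - A e) ^ 2 ≤ b * (δ ^ 2 * J) := by
      refine (hosc x e).trans ?_
      gcongr
    -- `b * φ x` splits as `A e + (A x - A e) - (A x - b * φ x)`; `A` is the integral over the ball,
    -- not divided by its volume `b`.
    have h5 : b ^ 2 * φ x ^ 2 ≤ 2 * (A x - b * φ x) ^ 2 + 4 * A e ^ 2 + 4 * (A x - A e) ^ 2 := by
      nlinarith [sq_nonneg (A x - b * φ x + A x), sq_nonneg (A x - A e - A e)]
    have h6 : b ^ 2 * φ x ^ 2 ≤ b ^ 2 * ((2 / b) * (∫ z in B, (φ (x + z) - φ x) ^ 2)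
        + (4 / b ^ 2 * Q + 4 / b * (δ ^ 2 * J))) := by
      have : b ^ 2 * ((2 / b) * (∫ z in B, (φ (x + z) - φ x) ^ 2)
        + (4 / b ^ 2 * Q + 4 / b * (δ ^ 2 * J))) =
        2 * (b * ∫ z in B, (φ (x + z) - φ x) ^ 2) + 4 * Q + 4 * (b * (δ ^ 2 * J)) := by
        field_simp; ring
      rw [this]; linarith
    exact le_of_mul_le_mul_left h6 (by positivity)
  have hprod : Integrable (Function.uncurry fun x z => (φ (x + z) - φ x) ^ 2)
      ((volume.restrict (Metric.closedBall (0 : E) R)).prod (volume.restrict B)) := by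
    refine Integrable.of_bound (C := (2 * Cφ) ^ 2) ?_ (Eventually.of_forall fun q => ?_)
    · exact Continuous.aestronglyMeasurable (by fun_prop)
    · simp only [Function.uncurry, norm_pow]
      exact pow_le_pow_left₀ (norm_nonneg _) (hbd _ _) 2
  have hI : IntegrableOn (fun x => ∫ z in B, (φ (x + z) - φ x) ^ 2)
      (Metric.closedBall (0 : E) R) := hprod.integral_prod_left
  have hI2 : IntegrableOn (fun x => (2 / b) * (∫ z in B, (φ (x + z) - φ x) ^ 2)
      + (4 / b ^ 2 * Q + 4 / b * (δ ^ 2 * J))) (Metric.closedBall (0 : E) R) :=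
    Integrable.add (hI.const_mul _) (integrable_const _)
  -- With `z` as the outer variable, the translation estimate applies for each `‖z‖ < ε`.
  have hdouble : ∫ x in Metric.closedBall (0 : E) R, ∫ z in B, (φ (x + z) - φ x) ^ 2
      ≤ b * (ε ^ 2 * J) := by
    rw [integral_integral_swap hprod]
    have : b * (ε ^ 2 * J) = ∫ z in B, ε ^ 2 * J := by simp [hb, Measure.real]
    rw [this]
    refine setIntegral_mono_on hprod.swap.integral_prod_left (integrable_const _)
      measurableSet_ball ?_
    intro z hz
    refine (setIntegral_le_integral ?_ (Eventually.of_forall fun z => sq_nonneg _)).trans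
      ((integral_sq_sub_translate_le hφ hc z).trans ?_)
    · refine Continuous.integrable_of_hasCompactSupport (by fun_prop) ?_
      have h1 : HasCompactSupport fun x => φ (x + z) :=
        hc.comp_homeomorph (Homeomorph.addRight z)
      exact (h1.sub hc).fun_sq
    · have : ‖z‖ < ε := by simpa [hB] using hz
      gcongr
  have hfull : ∫ x, φ x ^ 2 = ∫ x in Metric.closedBall (0 : E) R, φ x ^ 2 := by
    symm
    apply setIntegral_eq_integral_of_forall_compl_eq_zero
    intro x hx
    rw [image_eq_zero_of_notMem_tsupport fun h => hx (hR (hsupp h))]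
    simp
  rw [hfull]
  calc ∫ x in Metric.closedBall (0 : E) R, φ x ^ 2
      ≤ ∫ x in Metric.closedBall (0 : E) R,
          ((2 / b) * (∫ z in B, (φ (x + z) - φ x) ^ 2)
            + (4 / b ^ 2 * Q + 4 / b * (δ ^ 2 * J))) :=
        setIntegral_mono_on (integrable_sq_of_continuous hcont hc).integrableOn
          hI2 measurableSet_closedBall hpt
    _ = (2 / b) * (∫ x in Metric.closedBall (0 : E) R, ∫ z in B, (φ (x + z) - φ x) ^ 2)
          + V * (4 / b ^ 2 * Q + 4 / b * (δ ^ 2 * J)) := by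
        rw [integral_add (hI.const_mul _) (integrable_const _),
          integral_const_mul]
        simp [hV, Measure.real]
    _ ≤ (2 / b) * (b * (ε ^ 2 * J)) + V * (4 / b ^ 2 * Q + 4 / b * (δ ^ 2 * J)) := by
        gcongr
    _ = η / 2 * J + V / (V + 1) * (η / 2 * J) + V * (4 / b ^ 2) * Q := by
        rw [hε2, hδ2]; field_simp; ring
    _ ≤ η * J + V * (4 / b ^ 2) * Q := by
        have : V / (V + 1) ≤ 1 := by rw [div_le_one (by positivity)]; linarith
        have h2 : V / (V + 1) * (η / 2 * J) ≤ 1 * (η / 2 * J) := by gcongr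
        linarith

end Translation

/-! ### The space `H¹₀` and the first Dirichlet eigenvalue -/

section SobolevZero

variable {E : Type*} [NormedAddCommGroup E] [InnerProductSpace ℝ E]

lemma IsTestFunction.contDiff_one {U : Set E} {φ : E → ℝ} (h : IsTestFunction U φ) :
    ContDiff ℝ 1 φ := h.smooth.of_le (by exact_mod_cast le_top)

lemma IsTestFunction.eq_zero {U : Set E} {φ : E → ℝ} (h : IsTestFunction U φ) {x : E}
    (hx : x ∉ U) : φ x = 0 :=
  image_eq_zero_of_notMem_tsupport fun h' => hx (h.support h')

variable [FiniteDimensional ℝ E]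

lemma IsTestFunction.gradient_eq_zero {U : Set E} {φ : E → ℝ} (h : IsTestFunction U φ) {x : E}
    (hx : x ∉ U) : gradient φ x = 0 := by
  have : fderiv ℝ φ x = 0 := image_eq_zero_of_notMem_tsupport
    fun h' => hx (h.support (tsupport_fderiv_subset ℝ h'))
  simp [gradient, this]

lemma gradient_fun_add {φ ψ : E → ℝ} {x : E} (hφ : DifferentiableAt ℝ φ x)
    (hψ : DifferentiableAt ℝ ψ x) :
    gradient (φ + ψ) x = gradient φ x + gradient ψ x := by
  simp [gradient, fderiv_add hφ hψ]

lemma gradient_smul_const {φ : E → ℝ} (c : ℝ) {x : E} (hφ : DifferentiableAt ℝ φ x) :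
    gradient (c • φ) x = c • gradient φ x := by
  simp [gradient, fderiv_const_smul hφ c]

lemma exists_isTestFunction {U : Set E} (hU : IsOpen U) (hne : U.Nonempty) :
    ∃ φ : E → ℝ, IsTestFunction U φ ∧ (∀ x, 0 ≤ φ x) ∧ ∃ x, φ x ≠ 0 := by
  obtain ⟨x, hx⟩ := hne
  obtain ⟨f, hf1, hf2, hf3, hf4, hf5⟩ :=
    exists_contDiff_tsupport_subset (n := (⊤ : ℕ∞)) (hU.mem_nhds hx)
  exact ⟨f, ⟨hf3, hf2, hf1⟩, fun y => (hf4 ⟨y, rfl⟩).1, x, by simp [hf5]⟩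

variable [MeasurableSpace E] [BorelSpace E]

lemma IsTestFunction.memLp {U : Set E} {φ : E → ℝ} (h : IsTestFunction U φ) (V : Set E) :
    MemLp φ 2 (volume.restrict V) :=
  (h.smooth.continuous.memLp_of_hasCompactSupport h.compact).restrict V

lemma IsTestFunction.memLp_gradient {U : Set E} {φ : E → ℝ} (h : IsTestFunction U φ) (V : Set E) :
    MemLp (gradient φ) 2 (volume.restrict V) :=
  (h.contDiff_one.continuous_gradient_of_one_le.memLp_of_hasCompactSupport
    h.compact.gradient).restrict V

/-- The pairs `(φ, ∇φ)` for test functions `φ` on `U`, as elements of `L² × L²`. -/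
noncomputable def testPairs (U : Set E) :
    Submodule ℝ (Lp ℝ 2 (volume.restrict U) × Lp E 2 (volume.restrict U)) where
  carrier := {p | ∃ φ : E → ℝ, IsTestFunction U φ ∧ p.1 =ᵐ[volume.restrict U] φ ∧
    p.2 =ᵐ[volume.restrict U] gradient φ}
  zero_mem' := by
    refine ⟨0, ⟨contDiff_const, HasCompactSupport.zero, by simp [tsupport]⟩,
      Lp.coeFn_zero _ _ _, ?_⟩
    filter_upwards [Lp.coeFn_zero E 2 (volume.restrict U)] with x hx
    simp only [Prod.snd_zero, hx]
    simp [gradient]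
  add_mem' := by
    rintro p q ⟨φ, hφ, hp1, hp2⟩ ⟨ψ, hψ, hq1, hq2⟩
    refine ⟨φ + ψ, ⟨hφ.smooth.add hψ.smooth, hφ.compact.add hψ.compact,
      (tsupport_add φ ψ).trans (union_subset hφ.support hψ.support)⟩, ?_, ?_⟩
    · exact (Lp.coeFn_add _ _).trans (hp1.add hq1)
    · filter_upwards [Lp.coeFn_add p.2 q.2, hp2, hq2] with x hx h1 h2
      rw [Prod.snd_add, hx, Pi.add_apply, h1, h2, gradient_fun_add
        (hφ.contDiff_one.differentiable one_ne_zero x)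
        (hψ.contDiff_one.differentiable one_ne_zero x)]
  smul_mem' := by
    rintro c p ⟨φ, hφ, hp1, hp2⟩
    refine ⟨c • φ, ⟨hφ.smooth.const_smul c, hφ.compact.smul_left (f := fun _ => c),
      (tsupport_smul_subset_right (fun _ => c) φ).trans hφ.support⟩, ?_, ?_⟩
    · exact (Lp.coeFn_smul _ _).trans (hp1.const_smul c)
    · filter_upwards [Lp.coeFn_smul c p.2, hp2] with x hx h1
      rw [Prod.smul_snd, hx, Pi.smul_apply, h1, gradient_smul_const _
        (hφ.contDiff_one.differentiable one_ne_zero x)]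

lemma IsTestFunction.mem_testPairs {U : Set E} {φ : E → ℝ} (h : IsTestFunction U φ) :
    ((h.memLp U).toLp φ, (h.memLp_gradient U).toLp (gradient φ)) ∈ testPairs U :=
  ⟨φ, h, (h.memLp U).coeFn_toLp, (h.memLp_gradient U).coeFn_toLp⟩

/-- `H¹₀(U)` as a closed subspace of `L² × L²`, via the pairs (function, gradient). -/
noncomputable def sobolevZero (U : Set E) :
    Submodule ℝ (Lp ℝ 2 (volume.restrict U) × Lp E 2 (volume.restrict U)) :=
  (testPairs U).topologicalClosure

lemma isClosed_sobolevZero (U : Set E) : IsClosed (sobolevZero U : Set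
    (Lp ℝ 2 (volume.restrict U) × Lp E 2 (volume.restrict U))) :=
  Submodule.isClosed_topologicalClosure _

/-- A closed property of pairs holding for all test functions holds on `sobolevZero U`. -/
lemma sobolevZero_induction {U : Set E}
    {P : Lp ℝ 2 (volume.restrict U) × Lp E 2 (volume.restrict U) → Prop}
    (hP : IsClosed {p | P p})
    (h : ∀ φ (hφ : IsTestFunction U φ),
      P ((hφ.memLp U).toLp φ, (hφ.memLp_gradient U).toLp (gradient φ)))
    {p : Lp ℝ 2 (volume.restrict U) × Lp E 2 (volume.restrict U)} (hp : p ∈ sobolevZero U) :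
    P p := by
  refine closure_minimal (t := {p | P p}) ?_ hP hp
  rintro ⟨a, b⟩ ⟨φ, hφ, h1, h2⟩
  have e1 : a = (hφ.memLp U).toLp φ := Lp.ext (h1.trans (MemLp.coeFn_toLp _).symm)
  have e2 : b = (hφ.memLp_gradient U).toLp (gradient φ) :=
    Lp.ext (h2.trans (MemLp.coeFn_toLp _).symm)
  rw [e1, e2]
  exact h φ hφ

lemma MemH10.mem_sobolevZero {U : Set E} {f : E → ℝ} {G : E → E} (h : MemH10 U f G) :
    (h.memLp.toLp f, h.memLp_grad.toLp G) ∈ sobolevZero U := by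
  obtain ⟨φ, hφ, h1, h2⟩ := h.approx
  refine mem_closure_of_tendsto (b := atTop)
    (f := fun n => (((hφ n).memLp U).toLp (φ n), ((hφ n).memLp_gradient U).toLp (gradient (φ n))))
    ?_ (Eventually.of_forall fun n => (hφ n).mem_testPairs)
  refine Tendsto.prodMk_nhds ?_ ?_
  · exact (Lp.tendsto_Lp_iff_tendsto_eLpNorm'' _ (fun n => (hφ n).memLp U) f h.memLp).2 h1
  · exact (Lp.tendsto_Lp_iff_tendsto_eLpNorm'' _ (fun n => (hφ n).memLp_gradient U) G
      h.memLp_grad).2 h2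

/-- Together with `MemH10.mem_sobolevZero`, this identifies `MemH10` with the closed subspace, which
supplies its linear structure and its invariance under a.e. equality. -/
lemma memH10_of_mem_sobolevZero {U : Set E}
    {p : Lp ℝ 2 (volume.restrict U) × Lp E 2 (volume.restrict U)} (hp : p ∈ sobolevZero U)
    {f : E → ℝ} {G : E → E} (hf : p.1 =ᵐ[volume.restrict U] f)
    (hG : p.2 =ᵐ[volume.restrict U] G) : MemH10 U f G := by
  refine ⟨(memLp_congr_ae hf).1 (Lp.memLp p.1), (memLp_congr_ae hG).1 (Lp.memLp p.2), ?_⟩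
  obtain ⟨q, hq, hlim⟩ := mem_closure_iff_seq_limit.1 hp
  choose φ hφ h1 h2 using hq
  refine ⟨φ, hφ, ?_, ?_⟩
  · have := (Lp.tendsto_Lp_iff_tendsto_eLpNorm' _ _).1 ((continuous_fst.tendsto p).comp hlim)
    refine this.congr fun n => eLpNorm_congr_ae ?_
    filter_upwards [h1 n, hf] with x hx hx'
    simp [hx, hx']
  · have := (Lp.tendsto_Lp_iff_tendsto_eLpNorm' _ _).1 ((continuous_snd.tendsto p).comp hlim)
    refine this.congr fun n => eLpNorm_congr_ae ?_
    filter_upwards [h2 n, hG] with x hx hx'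
    simp [hx, hx']

lemma MemH10.congr {U : Set E} {f g : E → ℝ} {F G : E → E} (h : MemH10 U f F)
    (hf : f =ᵐ[volume.restrict U] g) (hG : F =ᵐ[volume.restrict U] G) : MemH10 U g G :=
  memH10_of_mem_sobolevZero h.mem_sobolevZero (h.memLp.coeFn_toLp.trans hf)
    (h.memLp_grad.coeFn_toLp.trans hG)

lemma MemH10.sub {U : Set E} {f g : E → ℝ} {F G : E → E} (hf : MemH10 U f F)
    (hg : MemH10 U g G) : MemH10 U (f - g) (F - G) := by
  refine memH10_of_mem_sobolevZero
    ((sobolevZero U).sub_mem hf.mem_sobolevZero hg.mem_sobolevZero) ?_ ?_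
  · exact (Lp.coeFn_sub _ _).trans (hf.memLp.coeFn_toLp.sub hg.memLp.coeFn_toLp)
  · exact (Lp.coeFn_sub _ _).trans (hf.memLp_grad.coeFn_toLp.sub hg.memLp_grad.coeFn_toLp)

lemma MemH10.const_smul {U : Set E} {f : E → ℝ} {F : E → E} (hf : MemH10 U f F) (c : ℝ) :
    MemH10 U (c • f) (c • F) := by
  refine memH10_of_mem_sobolevZero ((sobolevZero U).smul_mem c hf.mem_sobolevZero) ?_ ?_
  · exact (Lp.coeFn_smul _ _).trans (hf.memLp.coeFn_toLp.const_smul c)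
  · exact (Lp.coeFn_smul _ _).trans (hf.memLp_grad.coeFn_toLp.const_smul c)

lemma inner_toLp_toLp {α F : Type*} [MeasurableSpace α] {μ : Measure α} [NormedAddCommGroup F]
    [InnerProductSpace ℝ F] {f g : α → F} (hf : MemLp f 2 μ) (hg : MemLp g 2 μ) :
    inner ℝ (hf.toLp f) (hg.toLp g) = ∫ x, inner ℝ (f x) (g x) ∂μ := by
  rw [L2.inner_def]
  refine integral_congr_ae ?_
  filter_upwards [hf.coeFn_toLp, hg.coeFn_toLp] with x h1 h2
  rw [h1, h2]

lemma norm_toLp_sq {α F : Type*} [MeasurableSpace α] {μ : Measure α} [NormedAddCommGroup F]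
    [InnerProductSpace ℝ F] {f : α → F} (hf : MemLp f 2 μ) :
    ‖hf.toLp f‖ ^ 2 = ∫ x, ‖f x‖ ^ 2 ∂μ := by
  rw [← real_inner_self_eq_norm_sq, inner_toLp_toLp]
  simp_rw [real_inner_self_eq_norm_sq]

/-- A function in `H¹₀(U)` may be used to test the weak equation. -/
lemma WeakNegDiv.integral_inner_eq {U : Set E} {G F : E → E} {g f : E → ℝ}
    (h : WeakNegDiv U G g) (hG : MemLp G 2 (volume.restrict U))
    (hg : MemLp g 2 (volume.restrict U)) (hf : MemH10 U f F) :
    ∫ x in U, inner ℝ (F x) (G x) = ∫ x in U, g x * f x := by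
  have hP : ∀ p ∈ sobolevZero U, inner ℝ p.2 (hG.toLp G) = inner ℝ p.1 (hg.toLp g) := by
    intro p hp
    refine sobolevZero_induction
      (P := fun p => inner ℝ p.2 (hG.toLp G) = inner ℝ p.1 (hg.toLp g))
      (isClosed_eq (by fun_prop) (by fun_prop)) (fun φ hφ => ?_) hp
    rw [inner_toLp_toLp, inner_toLp_toLp]
    simpa [inner_gradient_eq_fderiv] using h φ hφ
  have := hP _ hf.mem_sobolevZero
  rw [inner_toLp_toLp, inner_toLp_toLp] at this
  simpa using this

lemma IsTestFunction.integral_sq {U : Set E} {φ : E → ℝ} (h : IsTestFunction U φ) :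
    ‖(h.memLp U).toLp φ‖ ^ 2 = ∫ x, φ x ^ 2 := by
  rw [norm_toLp_sq]
  simp only [Real.norm_eq_abs, sq_abs]
  exact setIntegral_eq_integral_of_forall_compl_eq_zero fun x hx => by simp [h.eq_zero hx]

lemma IsTestFunction.integral_norm_gradient_sq {U : Set E} {φ : E → ℝ} (h : IsTestFunction U φ) :
    ‖(h.memLp_gradient U).toLp (gradient φ)‖ ^ 2 = ∫ x, ‖gradient φ x‖ ^ 2 := by
  rw [norm_toLp_sq]
  exact setIntegral_eq_integral_of_forall_compl_eq_zero fun x hx => by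
    simp [h.gradient_eq_zero hx]

-- Integrals over balls are inner products with indicators, hence continuous on `L²`, so the
-- inequality passes from test functions to their closure.
open scoped Classical in
lemma ehrlingInequality_sobolevZero {U : Set E} (hU : Bornology.IsBounded U) :
    EhrlingInequality (sobolevZero U : Set
      (Lp ℝ 2 (volume.restrict U) × Lp E 2 (volume.restrict U))) := by
  intro η hη
  obtain ⟨s, ε, K, hK, hs⟩ := exists_integral_sq_le_ball_averages hU hη
  have hfin : ∀ e : E, (volume.restrict U) (Metric.ball e ε) ≠ ⊤ := fun e =>
    ((Measure.restrict_apply_le _ _).trans_lt measure_ball_lt_top).ne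
  set v : E → Lp ℝ 2 (volume.restrict U) := fun e =>
    indicatorConstLp 2 (measurableSet_ball (x := e) (ε := ε)) (hfin e) (1 : ℝ) with hv
  -- Distinct centres may give the same element of `L²`, so each summand is bounded by the whole sum
  -- over the image, at the price of a factor `s.card`.
  refine ⟨s.image v, K * s.card, fun p hp => ?_⟩
  refine sobolevZero_induction (P := fun p => ‖p.1‖ ^ 2 ≤ η * ‖p.2‖ ^ 2 +
    K * s.card * ∑ e ∈ s.image v, (inner ℝ e p.1) ^ 2)
    (isClosed_le (by fun_prop) (by fun_prop)) (fun φ hφ => ?_) hp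
  rw [hφ.integral_sq, hφ.integral_norm_gradient_sq]
  refine (hs φ hφ.contDiff_one hφ.compact hφ.support).trans ?_
  rw [mul_assoc]
  gcongr
  rw [← nsmul_eq_mul]
  refine Finset.sum_le_card_nsmul _ _ _ fun e he => ?_
  have h1 : ∫ x in Metric.ball e ε, φ x = inner ℝ (v e) ((hφ.memLp U).toLp φ) := by
    rw [hv, L2.inner_indicatorConstLp_one]
    rw [integral_congr_ae (ae_restrict_of_ae (hφ.memLp U).coeFn_toLp),
      Measure.restrict_restrict measurableSet_ball]
    refine setIntegral_eq_of_subset_of_forall_sdiff_eq_zero measurableSet_ball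
      inter_subset_left fun x hx => hφ.eq_zero fun h => hx.2 ⟨hx.1, h⟩
  rw [h1]
  exact Finset.single_le_sum (f := fun w => (inner ℝ w ((hφ.memLp U).toLp φ) : ℝ) ^ 2)
    (fun i _ => sq_nonneg _) (Finset.mem_image_of_mem v he)

lemma integral_sq_pos_of_not_ae_zero {α : Type*} [MeasurableSpace α] {μ : Measure α} {f : α → ℝ}
    (hf : MemLp f 2 μ) (h : ¬ f =ᵐ[μ] 0) : 0 < ∫ x, f x ^ 2 ∂μ := by
  refine lt_of_le_of_ne (integral_nonneg fun x => sq_nonneg _) fun h0 => h ?_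
  have := (integral_eq_zero_iff_of_nonneg (fun x => sq_nonneg (f x)) hf.integrable_sq).1 h0.symm
  filter_upwards [this] with x hx
  simpa using hx

/-- On a nonempty bounded open set the first Dirichlet eigenvalue is positive, is attained, and
is the optimal constant in the Poincaré inequality. -/
theorem firstDirichletEigenvalue_spec [Nontrivial E] {U : Set E} (hUo : IsOpen U)
    (hne : U.Nonempty) (hU : Bornology.IsBounded U) :
    0 < firstDirichletEigenvalue U ∧
    (∀ μ, IsDirichletEigenvalue U μ → firstDirichletEigenvalue U ≤ μ) ∧
    ∀ f G, MemH10 U f G →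
      firstDirichletEigenvalue U * ∫ x in U, f x ^ 2 ≤ ∫ x in U, ‖G x‖ ^ 2 := by
  obtain ⟨ψ, hψ, hψ0, hψ1⟩ := exists_isTestFunction hUo hne
  obtain ⟨m, w, hw, hw0, hEL, hray⟩ := (ehrlingInequality_sobolevZero hU).exists_minimizer
    (isClosed_sobolevZero U) ⟨_, subset_closure hψ.mem_testPairs, by
      rw [← norm_ne_zero_iff, ← pow_ne_zero_iff two_ne_zero, hψ.integral_sq]
      obtain ⟨x, hx⟩ := hψ1
      refine ((hψ.smooth.continuous.pow 2).integral_pos_of_hasCompactSupport_nonneg_nonzero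
        hψ.compact.fun_sq (fun x => sq_nonneg _) (x := x) (pow_ne_zero 2 hx)).ne'⟩
  -- If `m ≤ 0`, the Euler–Lagrange equation tested with the minimiser kills its gradient, and
  -- Poincaré then kills the minimiser.
  have hmpos : 0 < m := by
    obtain ⟨P, hP⟩ := exists_poincare hU
    have h1 : ‖w.1‖ ^ 2 ≤ P * ‖w.2‖ ^ 2 :=
      sobolevZero_induction (P := fun p => ‖p.1‖ ^ 2 ≤ P * ‖p.2‖ ^ 2)
        (isClosed_le (by fun_prop) (by fun_prop)) (fun φ hφ => by
          rw [hφ.integral_sq, hφ.integral_norm_gradient_sq]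
          exact hP φ hφ.contDiff_one hφ.compact hφ.support) hw
    have h2 := hEL w hw
    rw [real_inner_self_eq_norm_sq, real_inner_self_eq_norm_sq] at h2
    have h3 : 0 < ‖w.1‖ ^ 2 := by positivity
    by_contra hm
    have h4 : ‖w.2‖ ^ 2 ≤ 0 := by rw [h2]; exact mul_nonpos_of_nonpos_of_nonneg (by linarith) h3.le
    have h5 : ‖w.2‖ ^ 2 = 0 := le_antisymm h4 (sq_nonneg _)
    rw [h5, mul_zero] at h1
    linarith
  have hrayH : ∀ f G, MemH10 U f G → m * ∫ x in U, f x ^ 2 ≤ ∫ x in U, ‖G x‖ ^ 2 := by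
    intro f G h
    have := hray _ h.mem_sobolevZero
    rw [norm_toLp_sq, norm_toLp_sq] at this
    simpa using this
  have hmem : IsDirichletEigenvalue U m := by
    refine ⟨w.1, w.2, memH10_of_mem_sobolevZero hw .rfl .rfl, fun h => hw0 ?_, fun φ hφ => ?_⟩
    · exact Lp.eq_zero_iff_ae_eq_zero.2 h
    · have h1 := hEL _ (subset_closure hφ.mem_testPairs)
      have h2 : inner ℝ ((hφ.memLp_gradient U).toLp (gradient φ)) w.2
          = ∫ x in U, fderiv ℝ φ x (w.2 x) := by
        rw [L2.inner_def]
        refine integral_congr_ae ?_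
        filter_upwards [(hφ.memLp_gradient U).coeFn_toLp] with x hx
        rw [hx, inner_gradient_eq_fderiv]
      have h3 : m * inner ℝ w.1 ((hφ.memLp U).toLp φ) = ∫ x in U, m * w.1 x * φ x := by
        rw [L2.inner_def, ← integral_const_mul]
        refine integral_congr_ae ?_
        filter_upwards [(hφ.memLp U).coeFn_toLp] with x hx
        rw [hx]; simp; ring
      rw [← h2, ← h3]; exact h1
  have hle : ∀ μ, IsDirichletEigenvalue U μ → m ≤ μ := by
    rintro μ ⟨f, G, hf, hf0, heq⟩
    have h1 := heq.integral_inner_eq hf.memLp_grad (hf.memLp.const_mul μ) hf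
    have h2 := hrayH f G hf
    have h3 := integral_sq_pos_of_not_ae_zero hf.memLp hf0
    simp_rw [real_inner_self_eq_norm_sq, mul_assoc, ← pow_two, integral_const_mul] at h1
    rw [h1] at h2
    exact le_of_mul_le_mul_right h2 h3
  have hm : firstDirichletEigenvalue U = m :=
    IsLeast.csInf_eq (s := {μ | IsDirichletEigenvalue U μ}) ⟨hmem, hle⟩
  rw [hm]
  exact ⟨hmpos, hle, hrayH⟩

/-- Extension by zero maps `H¹₀(D)` to `H¹(C)`. -/
lemma MemH10.memH1_indicator {C D : Set E} (hD : MeasurableSet D) (hDC : D ⊆ C) {f : E → ℝ}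
    {F : E → E} (h : MemH10 D f F) : MemH1 C (D.indicator f) (D.indicator F) := by
  have hr : (volume.restrict C).restrict D = volume.restrict D :=
    Measure.restrict_restrict_of_subset hDC
  refine ⟨?_, ?_, fun φ hφ e => ?_⟩
  · rw [memLp_indicator_iff_restrict hD, hr]; exact h.memLp
  · rw [memLp_indicator_iff_restrict hD, hr]; exact h.memLp_grad
  have e1 : ∫ x in C, D.indicator f x * fderiv ℝ φ x e = ∫ x in D, f x * fderiv ℝ φ x e := by
    rw [← hr, ← integral_indicator hD]
    refine integral_congr_ae (Eventually.of_forall fun x => ?_)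
    by_cases hx : x ∈ D <;> simp [hx]
  have e2 : ∫ x in C, inner ℝ (D.indicator F x) e * φ x = ∫ x in D, inner ℝ (F x) e * φ x := by
    rw [← hr, ← integral_indicator hD]
    refine integral_congr_ae (Eventually.of_forall fun x => ?_)
    by_cases hx : x ∈ D <;> simp [hx]
  rw [e1, e2]
  have hd : Continuous fun x => fderiv ℝ φ x e :=
    (hφ.contDiff_one.continuous_fderiv one_ne_zero).clm_apply continuous_const
  have hdc : HasCompactSupport fun x => fderiv ℝ φ x e :=
    (hφ.compact.fderiv ℝ).mono fun x hx h0 => hx (by simp [h0])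
  have hm1 : MemLp (fun x => fderiv ℝ φ x e) 2 (volume.restrict D) :=
    (hd.memLp_of_hasCompactSupport hdc).restrict D
  have hm2 : MemLp (fun x => φ x • e) 2 (volume.restrict D) :=
    ((hφ.smooth.continuous.smul continuous_const).memLp_of_hasCompactSupport
      (hφ.compact.mono fun x hx h0 => hx (by simp [h0]))).restrict D
  -- Integration by parts against a fixed `φ` is a closed condition on the pair, so it suffices to
  -- check it for test functions `ψ` on `D`, where all integrals extend to the whole space.
  have key := sobolevZero_induction
    (P := fun p => inner ℝ p.1 (hm1.toLp _) = - inner ℝ p.2 (hm2.toLp _))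
    (isClosed_eq (by fun_prop) (by fun_prop)) (fun ψ hψ => ?_) h.mem_sobolevZero
  · rw [inner_toLp_toLp, inner_toLp_toLp] at key
    simpa [inner_smul_right, mul_comm] using key
  · rw [inner_toLp_toLp, inner_toLp_toLp]
    simp only [inner_smul_right, inner_gradient_eq_fderiv, RCLike.inner_apply, conj_trivial]
    have i1 : ∫ x in D, fderiv ℝ φ x e * ψ x = ∫ x, ψ x * fderiv ℝ φ x e := by
      simp_rw [mul_comm (ψ _)]
      exact setIntegral_eq_integral_of_forall_compl_eq_zero fun x hx => by
        simp [hψ.eq_zero hx]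
    have i2 : ∫ x in D, φ x * fderiv ℝ ψ x e = ∫ x, fderiv ℝ ψ x e * φ x := by
      simp_rw [mul_comm _ (φ _)]
      refine setIntegral_eq_integral_of_forall_compl_eq_zero fun x hx => ?_
      rw [← inner_gradient_eq_fderiv, hψ.gradient_eq_zero hx]; simp
    rw [i1, i2]
    have hd' : Continuous fun x => fderiv ℝ ψ x e :=
      (hψ.contDiff_one.continuous_fderiv one_ne_zero).clm_apply continuous_const
    refine integral_mul_fderiv_eq_neg_fderiv_mul_of_integrable ?_ ?_ ?_
      (fun x _ => hψ.contDiff_one.differentiable one_ne_zero x)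
      (fun x _ => hφ.contDiff_one.differentiable one_ne_zero x)
    · exact (hd'.mul hφ.smooth.continuous).integrable_of_hasCompactSupport hφ.compact.mul_left
    · exact (hψ.smooth.continuous.mul hd).integrable_of_hasCompactSupport hψ.compact.mul_right
    · exact (hψ.smooth.continuous.mul hφ.smooth.continuous).integrable_of_hasCompactSupport
        hψ.compact.mul_right

end SobolevZero

/-! ### The Dirichlet problem below the first eigenvalue -/

section WeakEquation

variable {E : Type*} [NormedAddCommGroup E] [InnerProductSpace ℝ E] [FiniteDimensional ℝ E]
  [MeasurableSpace E] [BorelSpace E]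

lemma WeakNegDiv.congr {U : Set E} {G G' : E → E} {g g' : E → ℝ} (h : WeakNegDiv U G g)
    (hG : G =ᵐ[volume.restrict U] G') (hg : g =ᵐ[volume.restrict U] g') : WeakNegDiv U G' g' := by
  intro φ hφ
  have e1 : ∫ x in U, fderiv ℝ φ x (G' x) = ∫ x in U, fderiv ℝ φ x (G x) :=
    integral_congr_ae (by filter_upwards [hG] with x hx; rw [hx])
  have e2 : ∫ x in U, g' x * φ x = ∫ x in U, g x * φ x :=
    integral_congr_ae (by filter_upwards [hg] with x hx; rw [hx])
  rw [e1, e2, h φ hφ]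

lemma WeakNegDiv.const_smul {U : Set E} {G : E → E} {g : E → ℝ} (h : WeakNegDiv U G g) (c : ℝ) :
    WeakNegDiv U (c • G) (c • g) := by
  intro φ hφ
  simp only [Pi.smul_apply, map_smul, smul_eq_mul, mul_assoc, integral_const_mul]
  rw [h φ hφ]

lemma WeakNegDiv.sub {U : Set E} {G G' : E → E} {g g' : E → ℝ} (h : WeakNegDiv U G g)
    (h' : WeakNegDiv U G' g') (hG : MemLp G 2 (volume.restrict U))
    (hG' : MemLp G' 2 (volume.restrict U)) (hg : MemLp g 2 (volume.restrict U))
    (hg' : MemLp g' 2 (volume.restrict U)) : WeakNegDiv U (G - G') (g - g') := by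
  intro φ hφ
  have i1 : ∀ F : E → E, MemLp F 2 (volume.restrict U) →
      Integrable (fun x => fderiv ℝ φ x (F x)) (volume.restrict U) := fun F hF => by
    simp_rw [← inner_gradient_eq_fderiv]
    refine (L2.integrable_inner (𝕜 := ℝ) ((hφ.memLp_gradient U).toLp _) (hF.toLp F)).congr ?_
    filter_upwards [(hφ.memLp_gradient U).coeFn_toLp, hF.coeFn_toLp] with x h1 h2
    rw [h1, h2]
  have i2 : ∀ f : E → ℝ, MemLp f 2 (volume.restrict U) →
      Integrable (fun x => f x * φ x) (volume.restrict U) := fun f hf =>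
    hf.integrable_mul (hφ.memLp U)
  simp only [Pi.sub_apply, map_sub, sub_mul]
  rw [integral_sub (i1 G hG) (i1 G' hG'), integral_sub (i2 g hg) (i2 g' hg'), h φ hφ, h' φ hφ]

/-- Below the first eigenvalue the homogeneous Dirichlet problem has only the zero solution. -/
lemma MemH10.ae_eq_zero_of_lt [Nontrivial E] {U : Set E} (hUo : IsOpen U) (hne : U.Nonempty)
    (hU : Bornology.IsBounded U) {lam : ℝ} (hlam : lam < firstDirichletEigenvalue U) {w : E → ℝ}
    {G : E → E} (hw : MemH10 U w G) (h : WeakNegDiv U G (fun x => lam * w x)) :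
    w =ᵐ[volume.restrict U] 0 := by
  by_contra h0
  exact absurd ((firstDirichletEigenvalue_spec hUo hne hU).2.1 lam ⟨w, G, hw, h0, h⟩)
    (not_le.2 hlam)

/-- The mean of the solution of `-Δf = λf + 1` with Dirichlet boundary condition is positive and
bounded by `|U| / (μ₁ - λ)` for `λ` below the first eigenvalue `μ₁`. -/
lemma MemH10.integral_pos_and_le [Nontrivial E] {U : Set E} (hUo : IsOpen U) (hne : U.Nonempty)
    (hU : Bornology.IsBounded U) {lam : ℝ} (hlam : lam < firstDirichletEigenvalue U) {f : E → ℝ}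
    {G : E → E} (hf : MemH10 U f G) (h : WeakNegDiv U G (fun x => lam * f x + 1)) :
    0 < ∫ x in U, f x ∧
      ∫ x in U, f x ≤ volume.real U / (firstDirichletEigenvalue U - lam) := by
  set m := firstDirichletEigenvalue U
  have : IsFiniteMeasure (volume.restrict U) := ⟨by simpa using hU.measure_lt_top⟩
  have hone : MemLp (fun _ : E => (1 : ℝ)) 2 (volume.restrict U) := memLp_const 1
  have hf1 : Integrable f (volume.restrict U) := hf.memLp.integrable (by norm_num)
  have hE := h.integral_inner_eq hf.memLp_grad ((hf.memLp.const_mul lam).add hone) hf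
  simp only [real_inner_self_eq_norm_sq] at hE
  have hE2 : ∫ x in U, (lam * f x + 1) * f x = lam * (∫ x in U, f x ^ 2) + ∫ x in U, f x := by
    rw [← integral_const_mul, ← integral_add (hf.memLp.integrable_sq.const_mul lam) hf1]
    congr 1; ext x; ring
  rw [hE2] at hE
  have hray := (firstDirichletEigenvalue_spec hUo hne hU).2.2 f G hf
  have hpos : 0 < ∫ x in U, f x ^ 2 := by
    -- If `f` vanished, the energy identity would give `G = 0`, and the equation would read `0 = ∫
    -- ψ` for every test function.
    refine integral_sq_pos_of_not_ae_zero hf.memLp fun h0 => ?_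
    have z1 : ∫ x in U, f x ^ 2 = 0 := by
      rw [integral_congr_ae (g := fun _ => (0 : ℝ))]
      · simp
      · filter_upwards [h0] with x hx; simp [hx]
    have z2 : ∫ x in U, f x = 0 := by
      rw [integral_congr_ae h0]; simp
    rw [z1, z2, mul_zero, add_zero] at hE
    have hG0 : G =ᵐ[volume.restrict U] 0 := by
      have := (integral_eq_zero_iff_of_nonneg (fun x => sq_nonneg ‖G x‖)
        hf.memLp_grad.norm.integrable_sq).1 hE
      filter_upwards [this] with x hx
      simpa using hx
    obtain ⟨ψ, hψ, hψ0, x, hx⟩ := exists_isTestFunction hUo hne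
    have h1 := (h.congr hG0 (g' := fun _ => 1) (by
      filter_upwards [h0] with x hx; simp [hx])) ψ hψ
    simp only [Pi.zero_apply, map_zero, integral_zero, one_mul] at h1
    have h2 : ∫ x in U, ψ x = ∫ x, ψ x :=
      setIntegral_eq_integral_of_forall_compl_eq_zero fun x hx => hψ.eq_zero hx
    have h3 := hψ.smooth.continuous.integral_pos_of_hasCompactSupport_nonneg_nonzero
      (μ := volume) hψ.compact hψ0 hx
    linarith
  have hcs := sq_integral_le_measureReal_mul hf.memLp
  rw [measureReal_restrict_apply_univ] at hcs
  set S := ∫ x in U, f x ^ 2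
  set I := ∫ x in U, f x
  have hV : 0 ≤ volume.real U := measureReal_nonneg
  have hd : 0 < m - lam := sub_pos.2 hlam
  -- Energy identity `∫ ‖G‖ ^ 2 = lam * S + I` combined with `m * S ≤ ∫ ‖G‖ ^ 2`.
  have hSI : (m - lam) * S ≤ I := by linarith
  have hI : 0 < I := lt_of_lt_of_le (mul_pos hd hpos) hSI
  refine ⟨hI, ?_⟩
  rw [le_div_iff₀ hd]
  have : I * (I * (m - lam)) ≤ I * volume.real U := by
    calc I * (I * (m - lam)) = (m - lam) * I ^ 2 := by ring
      _ ≤ (m - lam) * (volume.real U * S) := by gcongr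
      _ = volume.real U * ((m - lam) * S) := by ring
      _ ≤ volume.real U * I := by gcongr
      _ = I * volume.real U := mul_comm _ _
  exact le_of_mul_le_mul_left this hI

end WeakEquation

/-- Two a.e. strongly measurable functions on a product that agree on almost every slice agree
almost everywhere. -/
lemma ae_eq_prod_of_ae_ae_slice {α β : Type*} [MeasurableSpace α] [MeasurableSpace β]
    {μ : Measure α} {ν : Measure β} [SFinite μ] [SFinite ν] {f g : α × β → ℝ}
    (hf : AEStronglyMeasurable f (μ.prod ν)) (hg : AEStronglyMeasurable g (μ.prod ν))
    (h : ∀ᵐ t ∂ν, ∀ᵐ y ∂μ, f (y, t) = g (y, t)) : f =ᵐ[μ.prod ν] g := by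
  -- The coincidence set of `f` and `g` need not be measurable, so Fubini for null sets is applied
  -- to their measurable representatives.
  have hswap : ∀ k : α × β → ℝ, ∀ hk : AEStronglyMeasurable k (μ.prod ν),
      ∀ᵐ t ∂ν, ∀ᵐ y ∂μ, k (y, t) = hk.mk k (y, t) := fun k hk =>
    Measure.ae_ae_of_ae_prod (p := fun q : β × α => k (q.2, q.1) = hk.mk k (q.2, q.1))
      (Measure.measurePreserving_swap.quasiMeasurePreserving.ae hk.ae_eq_mk)
  have hmeas : MeasurableSet {q : β × α | hf.mk f q.swap = hg.mk g q.swap} :=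
    measurableSet_eq_fun (hf.stronglyMeasurable_mk.measurable.comp measurable_swap)
      (hg.stronglyMeasurable_mk.measurable.comp measurable_swap)
  have h1 : ∀ᵐ q ∂ν.prod μ, hf.mk f q.swap = hg.mk g q.swap := by
    rw [Measure.ae_prod_iff_ae_ae hmeas]
    filter_upwards [h, hswap f hf, hswap g hg] with t h1 h2 h3
    filter_upwards [h1, h2, h3] with y h1 h2 h3
    rw [Prod.swap_prod_mk, ← h2, ← h3, h1]
  have h2 : ∀ᵐ q ∂μ.prod ν, hf.mk f q = hg.mk g q :=
    Measure.measurePreserving_swap.quasiMeasurePreserving.ae h1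
  filter_upwards [hf.ae_eq_mk, hg.ae_eq_mk, h2] with q h1 h2 h3
  rw [h1, h2, h3]

/-! ### The square and the disk -/

section Geometry

lemma IsOpenSquare.isOpen {C : Set Plane} (hC : IsOpenSquare C) : IsOpen C := by
  obtain ⟨e, a, -, rfl⟩ := hC
  refine e.toHomeomorph.isOpenMap _ ?_
  simp only [ofPred_forall]
  exact isOpen_iInter_of_finite fun i => isOpen_Ioo.preimage (by fun_prop)

lemma IsOpenSquare.isBounded {C : Set Plane} (hC : IsOpenSquare C) : Bornology.IsBounded C := by
  obtain ⟨e, a, ha, rfl⟩ := hC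
  refine e.isometry.lipschitz.isBounded_image ?_
  refine isBounded_iff_forall_norm_le.2 ⟨2 * a, fun y hy => ?_⟩
  refine le_of_sq_le_sq ?_ (by positivity)
  rw [EuclideanSpace.norm_sq_eq, Fin.sum_univ_two, Real.norm_eq_abs, Real.norm_eq_abs, sq_abs,
    sq_abs]
  have h0 := hy 0
  have h1 := hy 1
  nlinarith [h0.1, h0.2, h1.1, h1.2]

/-- If `C \ closure D` were empty, `C = closure D` would be clopen, hence empty or the whole space,
against `D` nonempty and `C` bounded. A nonempty open set has positive measure. -/
lemma measureReal_diff_pos {E : Type*} [NormedAddCommGroup E] [NormedSpace ℝ E] [Nontrivial E]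
    [FiniteDimensional ℝ E] [MeasurableSpace E] [BorelSpace E] {μ : Measure E}
    [μ.IsAddHaarMeasure] {C D : Set E}
    (hCo : IsOpen C) (hCb : Bornology.IsBounded C) (hD : D.Nonempty) (hDC : closure D ⊆ C) :
    0 < μ.real (C \ D) := by
  have hne : (C \ closure D).Nonempty := by
    rw [nonempty_iff_ne_empty]
    intro h
    have heq : C = closure D := (sdiff_eq_empty.1 h).antisymm hDC
    have hclopen : IsClopen C := ⟨heq ▸ isClosed_closure, hCo⟩
    rcases isClopen_iff.1 hclopen with h0 | h1
    · obtain ⟨x, hx⟩ := hD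
      have := hDC (subset_closure hx)
      simp [h0] at this
    · rw [h1] at hCb
      exact NormedSpace.unbounded_univ ℝ E hCb
  have hpos : 0 < μ (C \ closure D) :=
    (hCo.sdiff isClosed_closure).measure_pos μ hne
  refine ENNReal.toReal_pos ?_ ((measure_mono sdiff_subset).trans_lt hCb.measure_lt_top).ne
  exact (hpos.trans_le (measure_mono (sdiff_subset_sdiff_right subset_closure))).ne'

end Geometry

/-! ### The function `phi` -/

section Phi

variable {C D : Set Plane}

lemma strictMonoOn_phi (hC : 0 < volume.real (C \ D)) (hD : 0 < volume.real D) :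
    StrictMonoOn (phi C D) (Ioo 0 (firstDirichletEigenvalue D)) := by
  intro s hs t ht hst
  unfold phi
  have h1 : 0 < firstDirichletEigenvalue D - t := sub_pos.2 ht.2
  have h0 : 0 < firstDirichletEigenvalue D - s := sub_pos.2 hs.2
  have hs0 := hs.1
  have ht0 := ht.1
  gcongr

lemma continuousOn_phi (hC : 0 < volume.real (C \ D)) :
    ContinuousOn (phi C D) (Ioo 0 (firstDirichletEigenvalue D)) := by
  unfold phi
  refine continuousOn_id.mul (continuousOn_const.add (continuousOn_id.mul
    (continuousOn_const.div (by fun_prop) fun t ht => ?_)))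
  exact (mul_pos hC (sub_pos.2 ht.2)).ne'

/-- Multiplying `phi t = l` by `W * (m - t)` removes the singularity at `m`. The difference of the
two sides is then a polynomial, equal to `-l * W * m < 0` at 0 and `m ^ 2 * V > 0` at `m`. -/
lemma exists_phi_eq (hC : 0 < volume.real (C \ D)) (hD : 0 < volume.real D) {l : ℝ} (hl : 0 < l) (hm : 0 < firstDirichletEigenvalue D) :
    ∃ t ∈ Ioo 0 (firstDirichletEigenvalue D), phi C D t = l := by
  set m := firstDirichletEigenvalue D with hmdef
  set V := volume.real D with hV
  set W := volume.real (C \ D) with hW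
  have hcont : ContinuousOn (fun t => t * ((W + V) * (m - t) + t * V) - l * W * (m - t))
      (Icc 0 m) := by fun_prop
  have h0 : (0 : ℝ) ∈ Ioo (0 * ((W + V) * (m - 0) + 0 * V) - l * W * (m - 0))
      (m * ((W + V) * (m - m) + m * V) - l * W * (m - m)) := by
    constructor
    · have : 0 < l * W * m := by positivity
      simpa using this
    · have : 0 < m * (m * V) := by positivity
      simpa using this
  obtain ⟨t, ht, hte⟩ := intermediate_value_Ioo hm.le hcont h0
  refine ⟨t, ht, ?_⟩
  have hmt : 0 < m - t := sub_pos.2 ht.2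
  unfold phi
  rw [← hmdef, ← hV, ← hW]
  have hmt' := hmt.ne'
  have hC' := hC.ne'
  field_simp
  simp only at hte
  linarith

end Phi

/-- If `-Δf = λf + 1` and `u - s` solves `-Δ(u - s) = λu` in `U`, both with Dirichlet boundary
condition and `λ` below the first eigenvalue, then `u = s (λf + 1)`. -/
lemma ae_eq_of_weakNegDiv_of_lt {E : Type*} [NormedAddCommGroup E] [InnerProductSpace ℝ E]
    [FiniteDimensional ℝ E] [MeasurableSpace E] [BorelSpace E] [Nontrivial E] {U : Set E}
    (hUo : IsOpen U) (hne : U.Nonempty) (hU : Bornology.IsBounded U) {lam s : ℝ}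
    (hlam : lam < firstDirichletEigenvalue U) {f u : E → ℝ} {F G : E → E}
    (hf : MemH10 U f F) (hfeq : WeakNegDiv U F (fun y => lam * f y + 1))
    (hu : MemH10 U (fun y => u y - s) G) (hueq : WeakNegDiv U G (fun y => lam * u y)) :
    ∀ᵐ y ∂volume.restrict U, u y = (lam * f y + 1) * s := by
  have : IsFiniteMeasure (volume.restrict U) := ⟨by simpa using hU.measure_lt_top⟩
  have hone : ∀ c : ℝ, MemLp (fun _ : E => c) 2 (volume.restrict U) := fun c => memLp_const c
  -- The difference `w = u - s - lam * s * f` satisfies `-Δ w = lam * w`, so it vanishes below the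
  -- first eigenvalue.
  have hw := hu.sub (hf.const_smul (lam * s))
  have hum : MemLp u 2 (volume.restrict U) := by
    have := hu.memLp.add (hone s)
    refine (memLp_congr_ae (Eventually.of_forall fun y => ?_)).1 this
    simp
  have hfm : MemLp (fun y => lam * f y + 1) 2 (volume.restrict U) :=
    (hf.memLp.const_mul lam).add (hone 1)
  have hweq := hueq.sub (hfeq.const_smul (lam * s)) hu.memLp_grad
    (hf.memLp_grad.const_smul (lam * s)) (hum.const_mul lam) (hfm.const_smul (lam * s))
  have h0 := hw.ae_eq_zero_of_lt hUo hne hU hlam (hweq.congr .rfl (Eventually.of_forall fun y => by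
    simp only [Pi.sub_apply, Pi.smul_apply, smul_eq_mul]; ring))
  filter_upwards [h0] with y hy
  simp only [Pi.sub_apply, Pi.smul_apply, smul_eq_mul, Pi.zero_apply] at hy
  linarith

/-! ### Proof of the proposition -/

theorem proposition2p3 (C : Set Plane) (hC : IsOpenSquare C) (c : Plane) (r : ℝ) (hr : 0 < r)
    (D : Set Plane) (hD : D = Metric.ball c r) (hDC : closure D ⊆ C) (L : ℝ) (hL : 0 < L)
    (μ₁ : ℝ) (hμ₁ : μ₁ = firstDirichletEigenvalue D) :
    StrictMonoOn (phi C D) (Ioo 0 μ₁) ∧ ContinuousOn (phi C D) (Ioo 0 μ₁) ∧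
    ∃ μ₀ ∈ Ioo 0 μ₁, phi C D μ₀ = firstDirichletEigenvalue (Ioo 0 L) ∧
      ∀ (lam : ℝ) (u : Plane × ℝ → ℝ) (v : ℝ → ℝ),
        0 < lam → lam < μ₁ → CoupledSystem C D L lam u v →
        ¬ (u =ᵐ[volume.restrict (D ×ˢ Ioo 0 L)] 0 ∧ v =ᵐ[volume.restrict (Ioo 0 L)] 0) →
        ¬ (v =ᵐ[volume.restrict (Ioo 0 L)] 0) ∧
        (∃ u₀ : Plane → ℝ, ReducedSystem C D L lam u₀ v ∧
          u₀ =ᵐ[volume.restrict (C \ D)] 0 ∧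
          (∀ᵐ z ∂(volume.restrict (D ×ˢ Ioo 0 L)), u z = (lam * u₀ z.1 + 1) * v z.2) ∧
          ((∀ᵐ z ∂(volume.restrict ((C \ D) ×ˢ Ioo 0 L)), u z = v z.2) →
            ∀ᵐ z ∂(volume.restrict (C ×ˢ Ioo 0 L)), u z = (lam * u₀ z.1 + 1) * v z.2)) ∧
        (∀ u₀ : Plane → ℝ, ReducedSystem C D L lam u₀ v →
          0 < ∫ y in D, u₀ y ∧ ∫ y in D, u₀ y ≤ volume.real D / (μ₁ - lam)) ∧
        μ₀ ≤ lam := by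
  have hDo : IsOpen D := hD ▸ Metric.isOpen_ball
  have hDb : Bornology.IsBounded D := hD ▸ Metric.isBounded_ball
  have hDne : D.Nonempty := hD ▸ Metric.nonempty_ball.2 hr
  have hDC' : D ⊆ C := subset_closure.trans hDC
  have hW : 0 < volume.real (C \ D) := measureReal_diff_pos hC.isOpen hC.isBounded hDne hDC
  have hV : 0 < volume.real D :=
    ENNReal.toReal_pos (hDo.measure_pos _ hDne).ne' hDb.measure_lt_top.ne
  have : IsFiniteMeasure (volume.restrict D) := ⟨by simpa using hDb.measure_lt_top⟩
  have hIne : (Ioo 0 L).Nonempty := nonempty_Ioo.2 hL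
  have hIb : Bornology.IsBounded (Ioo 0 L) := Metric.isBounded_Ioo 0 L
  obtain ⟨hm, -, -⟩ := firstDirichletEigenvalue_spec hDo hDne hDb
  obtain ⟨hl, hlmin, -⟩ := firstDirichletEigenvalue_spec isOpen_Ioo hIne hIb
  have hmono := strictMonoOn_phi hW hV
  obtain ⟨μ₀, hμ₀, hμ₀eq⟩ := exists_phi_eq hW hV hl hm
  subst hμ₁
  refine ⟨hmono, continuousOn_phi hW, μ₀, hμ₀, hμ₀eq, fun lam u v hlam0 hlam hsys hnt => ?_⟩
  obtain ⟨G, V, hu, hueq, hubd, hv, hveq⟩ := hsys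
  have hprod : ∀ S : Set Plane, (volume : Measure (Plane × ℝ)).restrict (S ×ˢ Ioo 0 L)
      = (volume.restrict S).prod (volume.restrict (Ioo 0 L)) := fun S => by
    rw [Measure.prod_restrict]; rfl
  have hum : AEStronglyMeasurable u ((volume.restrict D).prod (volume.restrict (Ioo 0 L))) := by
    rw [← hprod]
    exact hu.memLp.aestronglyMeasurable.mono_measure
      (Measure.restrict_mono (prod_mono_left hDC') le_rfl)
  have hvne : ¬ (v =ᵐ[volume.restrict (Ioo 0 L)] 0) := by
    -- With `v = 0`, almost every slice of `u` solves the homogeneous Dirichlet problem at `lam <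
    -- μ₁`, so `u` vanishes too.
    intro hv0
    refine hnt ⟨?_, hv0⟩
    rw [hprod]
    refine ae_eq_prod_of_ae_ae_slice hum aestronglyMeasurable_const ?_
    filter_upwards [hueq, hubd, hv0] with t h1 h2 h3
    simp only [h3, Pi.zero_apply, sub_zero] at h2
    exact h2.ae_eq_zero_of_lt hDo hDne hDb hlam h1
  have hred : ∀ u₀ : Plane → ℝ, ReducedSystem C D L lam u₀ v →
      0 < ∫ y in D, u₀ y ∧
        ∫ y in D, u₀ y ≤ volume.real D / (firstDirichletEigenvalue D - lam) := by
    rintro u₀ ⟨F, -, -, h1, h2, -, -⟩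
    exact h2.integral_pos_and_le hDo hDne hDb hlam h1
  have hex : ∃ u₀ : Plane → ℝ, ReducedSystem C D L lam u₀ v ∧
      u₀ =ᵐ[volume.restrict (C \ D)] 0 ∧
      (∀ᵐ z ∂(volume.restrict (D ×ˢ Ioo 0 L)), u z = (lam * u₀ z.1 + 1) * v z.2) ∧
      ((∀ᵐ z ∂(volume.restrict ((C \ D) ×ˢ Ioo 0 L)), u z = v z.2) →
        ∀ᵐ z ∂(volume.restrict (C ×ˢ Ioo 0 L)), u z = (lam * u₀ z.1 + 1) * v z.2) := by
    -- `v` is nonzero on a non-null set, so some single height has `v t ≠ 0` and also satisfies the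
    -- slice equation and boundary condition.
    obtain ⟨t, hvt, heqt, hbdt⟩ :=
      ((not_eventually.1 hvne).and_eventually (hueq.and hubd)).exists
    replace hvt : v t ≠ 0 := hvt
    set k : ℝ := (lam * v t)⁻¹ with hk
    set f₀ : Plane → ℝ := k • fun y => u (y, t) - v t with hf₀
    set F₀ : Plane → Plane := k • fun y => G (y, t) with hF₀
    have hf : MemH10 D f₀ F₀ := hbdt.const_smul k
    have hi1 : f₀ =ᵐ[volume.restrict D] D.indicator f₀ :=
      (indicator_ae_eq_restrict hDo.measurableSet).symm
    have hi2 : F₀ =ᵐ[volume.restrict D] D.indicator F₀ :=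
      (indicator_ae_eq_restrict hDo.measurableSet).symm
    have hfeq : WeakNegDiv D (D.indicator F₀) (fun y => lam * D.indicator f₀ y + 1) := by
      refine (heqt.const_smul k).congr hi2 ?_
      filter_upwards [hi1] with y hy
      rw [← hy]
      simp only [hf₀, Pi.smul_apply, smul_eq_mul, hk]
      field_simp
      ring
    have hind := hf.congr hi1 hi2
    have hslice : ∀ᵐ s ∂volume.restrict (Ioo 0 L), ∀ᵐ y ∂volume.restrict D,
        u (y, s) = (lam * D.indicator f₀ y + 1) * v s := by
      filter_upwards [hueq, hubd] with s h1 h2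
      exact ae_eq_of_weakNegDiv_of_lt hDo hDne hDb hlam hind hfeq h2 h1
    have hid : ∀ᵐ z ∂(volume.restrict (D ×ˢ Ioo 0 L)),
        u z = (lam * D.indicator f₀ z.1 + 1) * v z.2 := by
      rw [hprod]
      refine ae_eq_prod_of_ae_ae_slice hum ?_ hslice
      have h1 : AEStronglyMeasurable (fun z : Plane × ℝ => D.indicator f₀ z.1)
          ((volume.restrict D).prod (volume.restrict (Ioo 0 L))) :=
        hind.memLp.aestronglyMeasurable.comp_fst
      have h2 : AEStronglyMeasurable (fun z : Plane × ℝ => v z.2)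
          ((volume.restrict D).prod (volume.restrict (Ioo 0 L))) :=
        hv.memLp.aestronglyMeasurable.comp_snd
      exact ((h1.const_mul lam).add aestronglyMeasurable_const).mul h2
    refine ⟨D.indicator f₀, ⟨D.indicator F₀, V, hf.memH1_indicator hDo.measurableSet hDC', hfeq,
      hind, hv, hveq.congr .rfl ?_⟩, ?_, hid, fun hout => ?_⟩
    -- The slice formula gives `∫_D u(·,s) = (lam ∫_D u₀ + |D|) v(s)`, which turns the nonlocal term
    -- into a multiple of `v`.
    · filter_upwards [hslice] with s hs
      rw [integral_congr_ae hs, integral_mul_const,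
        integral_add ((hind.memLp.integrable (by norm_num)).const_mul lam) (integrable_const _),
        integral_const_mul]
      simp only [integral_const, measureReal_restrict_apply_univ, smul_eq_mul, mul_one]
      field_simp
      ring
    · filter_upwards [ae_restrict_mem (hC.isOpen.measurableSet.diff hDo.measurableSet)] with y hy
      simp [hy.2]
    · have hsplit : C ×ˢ Ioo 0 L = D ×ˢ Ioo 0 L ∪ (C \ D) ×ˢ Ioo 0 L := by
        rw [← union_prod, union_sdiff_cancel hDC']
      rw [hsplit, ae_restrict_union_iff]
      refine ⟨hid, ?_⟩
      filter_upwards [hout, ae_restrict_mem ((hC.isOpen.measurableSet.diff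
        hDo.measurableSet).prod measurableSet_Ioo)] with z hz hzm
      rw [hz, indicator_of_notMem hzm.1.2]
      ring
  refine ⟨hvne, hex, hred, ?_⟩
  obtain ⟨u₀, hu₀, -⟩ := hex
  obtain ⟨h1, h2⟩ := hred u₀ hu₀
  obtain ⟨F, V', -, -, -, hv', hveq'⟩ := hu₀
  -- Since `v ≠ 0`, the coefficient in its equation is a Dirichlet eigenvalue of `(0,L)`.
  have hle := hlmin _ ⟨v, V', hv', hvne, hveq'⟩
  rw [← hμ₀eq] at hle
  refine (hmono.le_iff_le hμ₀ ⟨hlam0, hlam⟩).1 (hle.trans ?_)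
  unfold phi
  have h3 : lam / volume.real (C \ D) * ∫ y in D, u₀ y ≤ lam *
      (volume.real D / (volume.real (C \ D) * (firstDirichletEigenvalue D - lam))) := by
    calc lam / volume.real (C \ D) * ∫ y in D, u₀ y
        ≤ lam / volume.real (C \ D) *
          (volume.real D / (firstDirichletEigenvalue D - lam)) := by gcongr
      _ = _ := by rw [div_mul_div_comm, mul_div_assoc]
  gcongr
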